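/- **Setting.** Let $T$ be a first-order theory in a language $L$, let $|T|=\max(|L|,\aleph_0)$, and let $D$ be a set of complete types of $T$ over $\emptyset$ in finitely many variables. A model of $T$ is a *$D$-model* if the type over $\emptyset$ of each of its finite tuples is in $D$. For a subset $A$ of a model $M$, $S^n_D(A)$ is the set of complete $n$-types $p$ over $A$ such that, whenever $\bar c$ realizes $p$ in an elementary extension of $M$, all finite tuples from $A\cup\bar c$ have their type over $\emptyset$ in $D$; $S_D=S_D^1$. A $D$-model $M$ is *$(D,\lambda)$-homogeneous* if it realizes every $p\in S_D(A)$ for every $A\subseteq M$ with $|A|<\lambda$. Fix a $(D,\chi)$-homogeneous model $\mathfrak C$; below, models are elementary submodels of $\mathfrak C$. For $A\subseteq\mathfrak C$ and a set $p(\bar x)$ of formulas over a finite subset of $A$ define: $R_A[p]\ge 0$ iff $p$ is realized in $\mathfrak C$; $R_A[p]\ge\delta$ ($\delta$ limit) iff $R_A[p]\ge\alpha$ for all $\alpha<\delta$; $R_A[p]\ge\alpha+1$ iff (a) there is a formula $\phi(\bar x,\bar a)$ with $\bar a\in A$ such that $R_A[p\cup\{\phi(\bar x,\bar a)\}]\ge\alpha$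 and $R_A[p\cup\{\neg\phi(\bar x,\bar a)\}]\ge\alpha$, and (b) for every finite $\bar a\in A$ there is $q(\bar x,\bar y)\in D$ with $R_A[p\cup q(\bar x,\bar a)]\ge\alpha$. For an arbitrary set $p$ of formulas over $A$, $R_A[p]$ is the minimum of $R_A[q]$ over the $q\subseteq p$ with finitely many parameters. $D$ is *totally transcendental* if $R_A[p]<\infty$ for all $A\subseteq\mathfrak C$ and all sets $p$ of formulas over $A$ in finitely many variables. A type $p\in S_D(A)$ is *$D^s_\mu$-isolated over $B\subseteq A$*, where $|B|<\mu$, if every $q\in S_D(A)$ extending $p\restriction B$ equals $p$. A model $M$ is *$D^s_\mu$-primary over $A$* if it is $(D,\mu)$-homogeneous and $M=A\cup\{a_i: i<\alpha\}$ for an ordinal $\alpha$ and elements $a_i$ such that, with $A_i=A\cup\{a_j:j<i\}$, each $\operatorname{tp}(a_i,A_i)$ is $D^s_\mu$-isolated over some $B_i\subseteq A_i$ with $|B_i|<\mu$. A model $M\supseteq A$ is *$D^s_\mu$-prime over $A$* if it is $(D,\mu)$-homogeneous and for every $(D,\mu)$-homogeneous model $N\supseteq A$ there is an elementary embedding $f:M\to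 N$ with $f\restriction A=\mathrm{id}_A$. **Theorem.** Suppose $D$ is totally transcendental, $A\subseteq\mathfrak C$, $\mu$ is an infinite cardinal, and $|A|+|T|+|D|+\mu<\chi$. Then there is a $D^s_\mu$-primary model $M$ over $A$ with $$|M|\le |A|+|T|+|D|+\mu .$$ If moreover $\mu\le|\mathfrak C|$ and every type in $D$ is realized in $\mathfrak C$, then also $|A|+|D|+\mu\le|M|$ (so that $|M|=|A|+|T|+|D|+\mu$ whenever $|T|\le|A|+|D|+\mu$). This model $M$ is also $D^s_\mu$-prime over $A$. -/

import Mathlib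

open FirstOrder Cardinal

universe u

namespace FiniteDiagram

/-- A diagram of `T`: a set of complete types of `T` over the empty set, in finitely many
variables. -/
abbrev Diagram {L : FirstOrder.Language.{u, u}} (T : L.Theory) : Type u :=
  Set (Σ n : ℕ, T.CompleteType (Fin n))

section Formulas

variable {L : FirstOrder.Language.{u, u}}

/-- The formula `φ` with each free variable `i` replaced by the variable `t i`. -/
def rename {α β : Type*} (φ : L.Formula α) (t : α → β) : L.Formula β :=
  FirstOrder.Language.BoundedFormula.subst φ (fun i => FirstOrder.Language.Term.var (t i))

/-- For a complete type `q(y₀, …, y_{k-1})` over the empty set, the set of formulas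
`q(t 0, …, t (k-1))`. -/
def instType {T : L.Theory} {k : ℕ} {β : Type u} (q : T.CompleteType (Fin k)) (t : Fin k → β) :
    Set (L.Formula β) :=
  {ψ | ∃ φ : L.Formula (Fin k), FirstOrder.Language.Formula.equivSentence φ ∈ q ∧ ψ = rename φ t}

variable {M : Type u}

/-- Formulas in the variables `x₀, …, x_{n-1}` (written `Sum.inr i`) with parameters in `M`
(written `Sum.inl a`) whose parameters all lie in `A`. -/
def formulasOver (L : FirstOrder.Language.{u, u}) (A : Set M) (n : ℕ) : Set (L.Formula (M ⊕ Fin n)) :=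
  Set.range fun φ : L.Formula (A ⊕ Fin n) => rename φ (Sum.map Subtype.val id)

variable [L.Structure M]

/-- The tuple `c` satisfies every formula in the set `p` of formulas with parameters in `M`. -/
def Realizes {n : ℕ} (c : Fin n → M) (p : Set (L.Formula (M ⊕ Fin n))) : Prop :=
  ∀ φ ∈ p, φ.Realize (Sum.elim id c)

/-- `tp(c, A)`. -/
def tp (L : FirstOrder.Language.{u, u}) [L.Structure M] {n : ℕ} (c : Fin n → M) (A : Set M) :
    Set (L.Formula (M ⊕ Fin n)) :=
  {φ | φ ∈ formulasOver L A n ∧ φ.Realize (Sum.elim id c)}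

/-- Complete `n`-types over `A ⊆ M`: maximal finitely satisfiable sets of formulas over `A`,
which are the types over `A` of the `n`-tuples from elementary extensions of `M`. -/
structure IsCompleteType {n : ℕ} (A : Set M) (p : Set (L.Formula (M ⊕ Fin n))) : Prop where
  subset_over : p ⊆ formulasOver L A n
  complete : ∀ φ ∈ formulasOver L A n, φ ∈ p ∨ φ.not ∈ p
  finitely_satisfiable : ∀ s ⊆ p, s.Finite → ∃ c : Fin n → M, Realizes c s

end Formulas

section Diagrams

variable {L : FirstOrder.Language.{u, u}} {T : L.Theory} (D : Diagram T)

/-- A model of `T` is a `D`-model if the type over `∅` of each of its finite tuples is in `D`. -/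
def IsDModel (M : Type u) [L.Structure M] [Nonempty M] [M ⊨ T] : Prop :=
  ∀ (k : ℕ) (c : Fin k → M), (⟨k, T.typeOf c⟩ : Σ n : ℕ, T.CompleteType (Fin n)) ∈ D

/-- The set `S_D^n(A)` of complete `n`-types `p` over `A` such that `A ∪ c` is a `D`-set for `c`
realizing `p` (in an elementary extension): for every finite tuple `t` of elements of `A` and
variables `xᵢ`, the complete type over `∅` which `p` prescribes for `t` belongs to `D`. -/
def SD {M : Type u} [L.Structure M] (A : Set M) (n : ℕ) : Set (Set (L.Formula (M ⊕ Fin n))) :=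
  {p | IsCompleteType A p ∧
    ∀ (k : ℕ) (t : Fin k → M ⊕ Fin n), (∀ i a, t i = Sum.inl a → a ∈ A) →
      ∃ q : T.CompleteType (Fin k),
        (⟨k, q⟩ : Σ n : ℕ, T.CompleteType (Fin n)) ∈ D ∧ instType q t ⊆ p}

/-- `(D, lam)`-homogeneous models: `D`-models realizing every type in `S_D(A)` over each subset
`A` of cardinality less than `lam`. -/
def IsHomogeneous (lam : Cardinal.{u}) (M : Type u) [L.Structure M] [Nonempty M] [M ⊨ T] : Prop :=
  IsDModel D M ∧
    ∀ A : Set M, #A < lam → ∀ p ∈ SD D A 1, ∃ c : Fin 1 → M, Realizes c p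

end Diagrams

section Rank

variable {L : FirstOrder.Language.{u, u}} {T : L.Theory} (D : Diagram T)
variable {C : Type u} [L.Structure C]

/-- `R_A[p] ≥ α`, for a set `p` of formulas with finitely many parameters, by recursion on `α`. -/
noncomputable def RankGEFin (A : Set C) {n : ℕ} (α : Ordinal.{u}) :
    Set (L.Formula (C ⊕ Fin n)) → Prop :=
  Ordinal.limitRecOn (motive := fun _ => Set (L.Formula (C ⊕ Fin n)) → Prop) α
    (fun p => ∃ c : Fin n → C, Realizes c p)
    (fun _ ge p =>
      (∃ φ ∈ formulasOver L A n, ge (p ∪ {φ}) ∧ ge (p ∪ {φ.not})) ∧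
      (∀ (m : ℕ) (a : Fin m → C), (∀ j, a j ∈ A) →
        ∃ q : T.CompleteType (Fin (n + m)),
          (⟨n + m, q⟩ : Σ n : ℕ, T.CompleteType (Fin n)) ∈ D ∧
          ge (p ∪ instType q (Fin.addCases (fun i => Sum.inr i) (fun j => Sum.inl (a j))))))
    (fun δ _ ge p => ∀ (β : Ordinal.{u}) (h : β < δ), ge β h p)

/-- `R_A[p] ≥ α` for an arbitrary set `p` of formulas over `A`: here `R_A[p]` is the minimum of
the ranks of the subsets of `p` which have only finitely many parameters. -/
def RankGE (A : Set C) {n : ℕ} (α : Ordinal.{u}) (p : Set (L.Formula (C ⊕ Fin n))) : Prop :=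
  ∀ B : Set C, B ⊆ A → B.Finite → ∀ q ⊆ p, q ⊆ formulasOver L B n → RankGEFin D A α q

/-- `D` is totally transcendental: `R_A[p] < ∞` for every type `p` over every subset `A` of the
large homogeneous model `C`. -/
def IsTotallyTranscendental (C : Type u) [L.Structure C] : Prop :=
  ∀ (A : Set C) (n : ℕ) (p : Set (L.Formula (C ⊕ Fin n))), p ⊆ formulasOver L A n →
    ∃ α : Ordinal.{u}, ¬ RankGE D A α p

end Rank

section Primary

variable {L : FirstOrder.Language.{u, u}} {T : L.Theory} (D : Diagram T) (lam : Cardinal.{u})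
variable {C : Type u} [L.Structure C]

/-- `p ∈ S_D(A)` is `D^s_lam`-isolated over `B ⊆ A`, `|B| < lam`. -/
def IsIsolatedOver (A B : Set C) (p : Set (L.Formula (C ⊕ Fin 1))) : Prop :=
  p ∈ SD D A 1 ∧ B ⊆ A ∧ #B < lam ∧
    ∀ q ∈ SD D A 1, p ∩ formulasOver L B 1 ⊆ q → q = p

/-- `X` is `D^s_lam`-constructible over `A`: there is a `(D, lam)`-construction
`⟨aᵢ, Aᵢ, Bᵢ : i < α⟩` of `X` over `A`, where `Aᵢ = A ∪ {aⱼ : j < i}`. -/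
def IsConstructible (A X : Set C) : Prop :=
  ∃ (α : Ordinal.{u}) (a : Ordinal.{u} → C) (B : Ordinal.{u} → Set C),
    X = A ∪ a '' Set.Iio α ∧
    ∀ i < α, IsIsolatedOver D lam (A ∪ a '' Set.Iio i) (B i)
      (tp L (fun _ => a i) (A ∪ a '' Set.Iio i))

variable [Nonempty C] [C ⊨ T]

/-- `M` is `D^s_lam`-primary over `A`. -/
def IsPrimary (A : Set C) (M : L.ElementarySubstructure C) : Prop :=
  IsConstructible D lam A (M : Set C) ∧ IsHomogeneous D lam M

/-- `M` is `D^s_lam`-prime over `A`: it is `(D, lam)`-homogeneous and embeds elementarily, by a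
map that fixes `A` pointwise, into every `(D, lam)`-homogeneous model `N` which contains `A`. -/
def IsPrimeOver (A : Set C) (M : L.ElementarySubstructure C) : Prop :=
  A ⊆ (M : Set C) ∧ IsHomogeneous D lam M ∧
    ∀ N : L.ElementarySubstructure C, IsHomogeneous D lam N → A ⊆ (N : Set C) →
      ∃ f : M ↪ₑ[L] N, ∀ x : M, (x : C) ∈ A → (f x : C) = (x : C)

end Primary

end FiniteDiagram

/-! Types are compared through partial elementary maps of `C`, that is, relations `Γ` on `C` with
`IsElem`; homogeneity extends each such map of size less than `χ` to any further element. Total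
transcendence is used only to bound a rank on realized types over finite sets (`TupleRankGE`).
Minimizing this rank yields three facts. A type over `B` has an extension to `X` determined by `B`
and finitely many elements of `X` (`BoundedTupleRank.exists_determines`). At most `|X| + |D| + ℵ₀`
types over `X` are realized in `C` (`BoundedTupleRank.exists_representatives`). If `X` realizes the
types over its finite subsets, the type over `X` of a finite tuple does not split over some finite
subset (`BoundedTupleRank.exists_nonSplitting`).

With `κ = |A| + |T| + |D| + μ`, the model is a union of `μ` blocks of length `κ`. Every added
element has a type determined by fewer than `μ` parameters, and each block realizes all types so
determined over the stage before it. A subset `B` contained in a proper stage is harmless: a type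
over `B` extends to a determined type over that stage, which the next block realizes. This settles
regular `μ`.

For singular `μ` a small `B` may be cofinal. Then one takes a stage `Y` below the top with
cofinality `|B|⁺`, a set `F ⊆ Y` of size at most `|B|` over which the types over `Y` of the finite
tuples of `B`, and the type of `c` over the whole, do not split, and `c' ∈ Y` realizing `tp(c, F)`.
That `c'` realizes `tp(c, B)` is a symmetry property (`NonSplitting.eqTp_of_eqTp`): its failure
would produce an indiscernible sequence ordered by a formula, and stretching that sequence to the
rationals would give unbounded rank (`OrderIndiscernible.eqTp`).

For primeness, an elementary map into a `(D, μ)`-homogeneous `N` extends along the construction,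
since a type determined by fewer than `μ` parameters is carried to one realized in `N`. -/

namespace FiniteDiagram

/-! ### Substitution of variables -/

section Rename

variable {L : FirstOrder.Language.{u, u}}

theorem realize_rename {N : Type*} [L.Structure N] {α β : Type*} (φ : L.Formula α) (t : α → β)
    (v : β → N) : (rename φ t).Realize v ↔ φ.Realize (v ∘ t) := by
  simp only [rename, Language.Formula.Realize, Language.BoundedFormula.realize_subst,
    Language.Term.realize_var]
  rfl

theorem rename_rename {α β γ : Type*} (φ : L.Formula α) (t : α → β) (s : β → γ) :
    rename (rename φ t) s = rename φ (s ∘ t) := by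
  have key : ∀ (n : ℕ) (x : L.Term (α ⊕ Fin n)),
      ((x.subst (Sum.elim (Language.Term.relabel Sum.inl ∘
          fun i => Language.Term.var (t i)) (Language.Term.var ∘ Sum.inr))).subst
        (Sum.elim (Language.Term.relabel Sum.inl ∘ fun i => Language.Term.var (s i))
          (Language.Term.var ∘ Sum.inr)) : L.Term (γ ⊕ Fin n)) =
      x.subst (Sum.elim (Language.Term.relabel Sum.inl ∘
        fun i => Language.Term.var (s (t i))) (Language.Term.var ∘ Sum.inr)) := by
    intro n x
    induction x with
    | var i => rcases i with i | i <;> rfl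
    | func f ts ih => simp only [Language.Term.subst, ih]
  unfold rename Language.BoundedFormula.subst
  erw [Language.BoundedFormula.mapTermRel_mapTermRel]
  congr 1
  funext n x
  exact key n x

end Rename

/-! ### Partial elementary maps and equality of types -/

section Elementary

variable (L : FirstOrder.Language.{u, u}) {C : Type u} [L.Structure C]

/-- The relation `Γ` on `C` is elementary: corresponding tuples satisfy the same formulas. -/
def IsElem (Γ : Set (C × C)) : Prop :=
  ∀ φ : L.Formula Γ, φ.Realize (fun z => z.1.1) ↔ φ.Realize (fun z => z.1.2)

/-- The pairs of equal elements of `X`. -/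
def diag (X : Set C) : Set (C × C) := (fun x => (x, x)) '' X

/-- The pairs of corresponding entries of two families. -/
def pairs {ι : Type*} (c d : ι → C) : Set (C × C) := Set.range fun i => (c i, d i)

/-- `c` and `d` have the same type over `X`. -/
def EqTp (X : Set C) {ι : Type*} (c d : ι → C) : Prop := IsElem L (diag X ∪ pairs c d)

variable {L}

theorem mem_diag {X : Set C} {z : C × C} : z ∈ diag X ↔ z.1 ∈ X ∧ z.1 = z.2 := by
  constructor
  · rintro ⟨x, hx, rfl⟩
    exact ⟨hx, rfl⟩
  · rintro ⟨h1, h2⟩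
    exact ⟨z.1, h1, Prod.ext rfl h2⟩

theorem diag_mono {X Y : Set C} (h : X ⊆ Y) : diag X ⊆ diag Y := Set.image_mono h

theorem diag_union (X Y : Set C) : diag (X ∪ Y) = diag X ∪ diag Y := Set.image_union _ _ _

theorem pairs_const {ι : Type*} [Nonempty ι] (c d : C) :
    pairs (fun _ : ι => c) (fun _ => d) = {(c, d)} := by
  simp [pairs]

theorem pairs_self {ι : Type*} (c : ι → C) : pairs c c = diag (Set.range c) := by
  rw [diag, ← Set.range_comp]
  rfl

theorem IsElem.realize_iff {Γ : Set (C × C)} (h : IsElem L Γ) {β : Type*} (c d : β → C)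
    (hz : ∀ b, (c b, d b) ∈ Γ) (φ : L.Formula β) : φ.Realize c ↔ φ.Realize d := by
  have := h (φ.relabel fun b => ⟨(c b, d b), hz b⟩)
  rw [Language.Formula.realize_relabel, Language.Formula.realize_relabel] at this
  exact this

theorem IsElem.mono {Γ Δ : Set (C × C)} (h : IsElem L Δ) (hs : Γ ⊆ Δ) : IsElem L Γ :=
  fun φ => h.realize_iff _ _ (fun z => hs z.2) φ

theorem IsElem.comp {Γ Δ Θ : Set (C × C)} (h₁ : IsElem L Γ) (h₂ : IsElem L Δ)
    (h : ∀ z ∈ Θ, ∃ y, (z.1, y) ∈ Γ ∧ (y, z.2) ∈ Δ) : IsElem L Θ := by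
  intro φ
  choose f hf hg using h
  exact (h₁.realize_iff _ (fun z : Θ => f z.1 z.2) (fun z => hf z.1 z.2) φ).trans
    (h₂.realize_iff _ _ (fun z => hg z.1 z.2) φ)

theorem IsElem.inv {Γ Θ : Set (C × C)} (h₁ : IsElem L Γ) (h : ∀ z ∈ Θ, (z.2, z.1) ∈ Γ) :
    IsElem L Θ :=
  fun φ => (h₁.realize_iff (fun z : Θ => z.1.2) (fun z => z.1.1) (fun z => h z.1 z.2) φ).symm

theorem isElem_diag (X : Set C) : IsElem L (diag X) := by
  intro φ
  rw [show (fun z : diag X => z.1.1) = fun z : diag X => z.1.2 from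
    funext fun z => (mem_diag.1 z.2).2]

/-- Equality is a formula, so an elementary relation is the graph of an injective partial map. -/
theorem IsElem.eq_iff {Γ : Set (C × C)} (h : IsElem L Γ) {x x' y y' : C} (h1 : (x, y) ∈ Γ)
    (h2 : (x', y') ∈ Γ) : x = x' ↔ y = y' := by
  have := h.realize_iff ![x, x'] ![y, y'] (by intro b; fin_cases b <;> assumption)
    ((Language.Term.var 0).equal (Language.Term.var 1))
  simpa [Language.Formula.realize_equal] using this

/-- A formula has finitely many free variables. This finite character handles unions of chains and
types over infinite sets. -/
theorem isElem_of_finite {Γ : Set (C × C)} (h : ∀ Δ ⊆ Γ, Δ.Finite → IsElem L Δ) : IsElem L Γ := by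
  classical
  intro φ
  let ψ : L.Formula φ.freeVarFinset := φ.restrictFreeVar id
  have key : ∀ v : Γ → C, φ.Realize v ↔ ψ.Realize (fun z => v z.1) := fun v =>
    (Language.BoundedFormula.realize_restrictFreeVar (φ := φ) (f := id)
      (v := fun z : φ.freeVarFinset => v z.1) v (fun _ => rfl)).symm
  rw [key, key]
  refine (h (Subtype.val '' (φ.freeVarFinset : Set Γ)) ?_ ?_).realize_iff _ _ ?_ _
  · rintro _ ⟨z, -, rfl⟩
    exact z.2
  · exact (Finset.finite_toSet _).image _
  · intro z
    exact ⟨z.1, z.2, rfl⟩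

theorem EqTp.refl (X : Set C) {ι : Type*} (c : ι → C) : EqTp L X c c := by
  rw [EqTp, pairs_self, ← diag_union]
  exact isElem_diag _

theorem EqTp.symm {X : Set C} {ι : Type*} {c d : ι → C} (h : EqTp L X c d) : EqTp L X d c := by
  refine IsElem.inv h ?_
  rintro z (hz | ⟨i, rfl⟩)
  · exact Or.inl (mem_diag.2 ⟨(mem_diag.1 hz).2 ▸ (mem_diag.1 hz).1, (mem_diag.1 hz).2.symm⟩)
  · exact Or.inr ⟨i, rfl⟩

theorem EqTp.trans {X : Set C} {ι : Type*} {c d e : ι → C} (h : EqTp L X c d)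
    (h' : EqTp L X d e) : EqTp L X c e := by
  refine IsElem.comp h h' ?_
  rintro z (hz | ⟨i, rfl⟩)
  · exact ⟨z.1, Or.inl (mem_diag.2 ⟨(mem_diag.1 hz).1, rfl⟩), Or.inl hz⟩
  · exact ⟨d i, Or.inr ⟨i, rfl⟩, Or.inr ⟨i, rfl⟩⟩

theorem EqTp.mono {X Y : Set C} {ι : Type*} {c d : ι → C} (h : EqTp L Y c d) (hs : X ⊆ Y) :
    EqTp L X c d :=
  IsElem.mono h (Set.union_subset_union_left _ (diag_mono hs))

theorem EqTp.comp {X : Set C} {ι κ : Type*} {c d : ι → C} (h : EqTp L X c d) (f : κ → ι) :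
    EqTp L X (c ∘ f) (d ∘ f) :=
  IsElem.mono h (Set.union_subset_union_right _ (by rintro _ ⟨i, rfl⟩; exact ⟨f i, rfl⟩))

theorem eqTp_iff {X : Set C} {ι : Type*} {c d : ι → C} : EqTp L X c d ↔
    ∀ φ : L.Formula (X ⊕ ι), φ.Realize (Sum.elim Subtype.val c) ↔
      φ.Realize (Sum.elim Subtype.val d) := by
  constructor
  · intro h φ
    refine IsElem.realize_iff h _ _ ?_ φ
    rintro (x | i)
    · exact Or.inl ⟨x, x.2, rfl⟩
    · exact Or.inr ⟨i, rfl⟩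
  · intro h φ
    have hex : ∀ z : ↥(diag X ∪ pairs c d), ∃ s : X ⊕ ι,
        z.1.1 = Sum.elim Subtype.val c s ∧ z.1.2 = Sum.elim Subtype.val d s := by
      rintro ⟨_, ⟨x, hx, rfl⟩ | ⟨i, rfl⟩⟩
      · exact ⟨Sum.inl ⟨x, hx⟩, rfl, rfl⟩
      · exact ⟨Sum.inr i, rfl, rfl⟩
    choose f hf hg using hex
    have := h (φ.relabel f)
    rw [Language.Formula.realize_relabel, Language.Formula.realize_relabel] at this
    rwa [funext hf, funext hg]

/-- Elements with the same type over `X` as an element of `X` are equal to it. -/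
theorem EqTp.eq_of_mem {X : Set C} {ι : Type*} {c d : ι → C} (h : EqTp L X c d) (i : ι)
    (hi : c i ∈ X) : d i = c i :=
  ((IsElem.eq_iff h (Or.inl ⟨c i, hi, rfl⟩) (Or.inr ⟨i, rfl⟩)).1 rfl).symm

end Elementary

/-! ### Homogeneity in terms of elementary maps and realized types -/

section Homogeneity

variable {L : FirstOrder.Language.{u, u}} {T : L.Theory} {D : Diagram T}

theorem realize_sumMap_iff {N : Type u} [L.Structure N] {Y : Set N} {n : ℕ}
    (ψ : L.Formula (Y ⊕ Fin n)) (d : Fin n → N) :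
    (rename ψ (Sum.map Subtype.val id)).Realize (Sum.elim id d) ↔
      ψ.Realize (Sum.elim Subtype.val d) := by
  rw [realize_rename, Sum.elim_comp_map]
  rfl

/-- Extension of elementary maps: the type of an element of a `D`-model, moved by an elementary
map to a small subset of a homogeneous model, is realized there. -/
theorem IsHomogeneous.exists_realize {N : Type u} [L.Structure N] [Nonempty N] [N ⊨ T]
    {lam : Cardinal.{u}} (hN : IsHomogeneous D lam N)
    {P : Type u} [L.Structure P] [Nonempty P] [P ⊨ T] (hP : IsDModel D P)
    (Y : Set N) (hY : #Y < lam) (g : Y → P)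
    (hg : ∀ φ : L.Formula Y, φ.Realize Subtype.val ↔ φ.Realize g) (c : P) :
    ∃ d : N, ∀ ψ : L.Formula (Y ⊕ Fin 1),
      ψ.Realize (Sum.elim g fun _ => c) ↔ ψ.Realize (Sum.elim Subtype.val fun _ => d) := by
  -- The type of `c` over the image of `g`, with parameters pulled back to `Y`. Elementarity of `g`,
  -- applied to an existential formula, makes it finitely satisfiable in `N`.
  let p : Set (L.Formula (N ⊕ Fin 1)) :=
    {φ | ∃ ψ : L.Formula (Y ⊕ Fin 1), φ = rename ψ (Sum.map Subtype.val id) ∧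
      ψ.Realize (Sum.elim g fun _ => c)}
  have hp : p ∈ SD D Y 1 := by
    refine ⟨⟨?_, ?_, ?_⟩, ?_⟩
    · rintro _ ⟨ψ, rfl, -⟩
      exact ⟨ψ, rfl⟩
    · rintro _ ⟨ψ, rfl⟩
      by_cases h : ψ.Realize (Sum.elim g fun _ => c)
      · exact Or.inl ⟨ψ, rfl, h⟩
      · exact Or.inr ⟨ψ.not, rfl, h⟩
    · intro s hs hfin
      choose! ψ hψ hψ' using show ∀ φ ∈ s, ∃ ψ : L.Formula (Y ⊕ Fin 1),
        φ = rename ψ (Sum.map Subtype.val id) ∧ ψ.Realize (Sum.elim g fun _ => c) from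
          fun φ hφ => hs hφ
      have := hfin.to_subtype
      let θ : L.Formula Y := (Language.Formula.iInf fun x : s => ψ x.1).iExs (Fin 1)
      have h1 : θ.Realize g := by
        rw [Language.Formula.realize_iExs]
        refine ⟨fun _ => c, ?_⟩
        rw [Language.Formula.realize_iInf]
        exact fun x => hψ' _ x.2
      rw [← hg, Language.Formula.realize_iExs] at h1
      obtain ⟨d, hd⟩ := h1
      rw [Language.Formula.realize_iInf] at hd
      refine ⟨d, fun φ hφ => ?_⟩
      rw [hψ φ hφ, realize_sumMap_iff]
      exact hd ⟨φ, hφ⟩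
    · intro k t ht
      have hex : ∀ i, ∃ s : Y ⊕ Fin 1, t i = Sum.map Subtype.val id s := by
        intro i
        rcases h : t i with a | j
        · exact ⟨Sum.inl ⟨a, ht i a h⟩, rfl⟩
        · exact ⟨Sum.inr j, rfl⟩
      choose s hs using hex
      refine ⟨T.typeOf fun i => Sum.elim g (fun _ => c) (s i), hP _ _, ?_⟩
      rintro _ ⟨φ, hφ, rfl⟩
      rw [Language.Theory.CompleteType.formula_mem_typeOf] at hφ
      refine ⟨rename φ s, ?_, ?_⟩
      · rw [rename_rename, show t = Sum.map Subtype.val id ∘ s from funext hs]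
      · rw [realize_rename]
        exact hφ
  obtain ⟨d, hd⟩ := hN.2 Y hY p hp
  have hd' : (fun _ => d 0) = d := funext fun i => by rw [Subsingleton.elim i 0]
  have key : ∀ ψ : L.Formula (Y ⊕ Fin 1), ψ.Realize (Sum.elim g fun _ => c) →
      ψ.Realize (Sum.elim Subtype.val fun _ => d 0) := by
    intro ψ h
    rw [hd', ← realize_sumMap_iff]
    exact hd _ ⟨ψ, rfl, h⟩
  refine ⟨d 0, fun ψ => ⟨key ψ, fun h => ?_⟩⟩
  by_contra hn
  exact key ψ.not hn h

theorem formulasOver_mono {C : Type u} {A B : Set C} (h : B ⊆ A) (n : ℕ) :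
    formulasOver L B n ⊆ formulasOver L A n := by
  rintro _ ⟨ψ, rfl⟩
  refine ⟨rename ψ (Sum.map (Set.inclusion h) id), ?_⟩
  simp only [rename_rename]
  congr 1
  funext s
  rcases s with s | s <;> rfl

variable {C : Type u} [L.Structure C]

variable (L) in
/-- Elementary relations of size less than `χ` extend to any further element. -/
def ExtendsElem (C : Type u) [L.Structure C] (χ : Cardinal.{u}) : Prop :=
  ∀ Γ : Set (C × C), IsElem L Γ → #Γ < χ → ∀ c : C, ∃ d, IsElem L (insert (c, d) Γ)

variable (L) in
/-- Every type over a subset of `X` of size less than `lam` which is realized in `C` is realized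
in `X`. -/
def RealizesSmall (lam : Cardinal.{u}) (X : Set C) : Prop :=
  ∀ B ⊆ X, #B < lam → ∀ c : C, ∃ d ∈ X, EqTp L B (fun _ : Fin 1 => c) (fun _ => d)

theorem mem_tp_iff {A : Set C} {n : ℕ} {c : Fin n → C} (ψ : L.Formula (A ⊕ Fin n)) :
    rename ψ (Sum.map Subtype.val id) ∈ tp L c A ↔ ψ.Realize (Sum.elim Subtype.val c) := by
  rw [← realize_sumMap_iff]
  exact ⟨fun h => h.2, fun h => ⟨⟨ψ, rfl⟩, h⟩⟩

theorem tp_eq_iff {A : Set C} {n : ℕ} {c d : Fin n → C} :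
    tp L c A = tp L d A ↔ EqTp L A c d := by
  rw [eqTp_iff]
  constructor
  · intro h ψ
    rw [← mem_tp_iff, ← mem_tp_iff, h]
  · intro h
    ext φ
    constructor
    · rintro ⟨⟨ψ, rfl⟩, h'⟩
      exact (mem_tp_iff ψ).2 ((h ψ).1 ((realize_sumMap_iff _ _).1 h'))
    · rintro ⟨⟨ψ, rfl⟩, h'⟩
      exact (mem_tp_iff ψ).2 ((h ψ).2 ((realize_sumMap_iff _ _).1 h'))

theorem eq_tp_of_realizes {A : Set C} {n : ℕ} {c : Fin n → C} {q : Set (L.Formula (C ⊕ Fin n))}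
    (hq : IsCompleteType A q) (h : Realizes c q) : q = tp L c A := by
  ext φ
  refine ⟨fun hφ => ⟨hq.subset_over hφ, h φ hφ⟩, fun hφ => ?_⟩
  refine (hq.complete φ hφ.1).resolve_right fun hn => ?_
  exact h _ hn hφ.2

variable [Nonempty C] [C ⊨ T] {χ : Cardinal.{u}}

/-- The type of `c` over the first coordinates of `Γ` is carried to the second coordinates by a
section `g`; injectivity of `Γ` makes the choice of section immaterial. -/
theorem IsHomogeneous.extendsElem (hC : IsHomogeneous D χ C) : ExtendsElem L C χ := by
  intro Γ hΓ hc c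
  have hex : ∀ y : Prod.snd '' Γ, ∃ x, (x, y.1) ∈ Γ := by
    rintro ⟨_, ⟨x, y⟩, h, rfl⟩
    exact ⟨x, h⟩
  choose g hg using hex
  obtain ⟨d, hd⟩ := hC.exists_realize hC.1 (Prod.snd '' Γ) (mk_image_le.trans_lt hc) g
    (fun φ => (hΓ.realize_iff _ _ hg φ).symm) c
  refine ⟨d, fun φ => ?_⟩
  have hex : ∀ z : ↥(insert (c, d) Γ), ∃ s : (Prod.snd '' Γ) ⊕ Fin 1,
      z.1.1 = Sum.elim g (fun _ => c) s ∧ z.1.2 = Sum.elim Subtype.val (fun _ => d) s := by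
    rintro ⟨⟨x, y⟩, h | h⟩
    · exact ⟨Sum.inr 0, congrArg Prod.fst h, congrArg Prod.snd h⟩
    · refine ⟨Sum.inl ⟨y, (x, y), h, rfl⟩, ?_, rfl⟩
      exact (hΓ.eq_iff h (hg ⟨y, (x, y), h, rfl⟩)).2 rfl
  choose f hf hf' using hex
  have := hd (φ.relabel f)
  rw [Language.Formula.realize_relabel, Language.Formula.realize_relabel] at this
  rwa [funext hf, funext hf']

/-- An elementary substructure which is `(D, lam)`-homogeneous realizes the small types realized
in the ambient model. -/
theorem IsHomogeneous.realizesSmall (hC : IsDModel D C) {lam : Cardinal.{u}}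
    {N : L.ElementarySubstructure C} (hN : IsHomogeneous D lam N) :
    RealizesSmall L lam (N : Set C) := by
  intro B hB hc c
  let Y : Set N := {y | (y : C) ∈ B}
  have hYc : #Y ≤ #B := mk_le_of_injective (f := fun y : Y => (⟨y.1, y.2⟩ : B)) (by
    intro y z h
    exact Subtype.ext (Subtype.ext (congrArg (fun b : B => b.1) h)))
  obtain ⟨d, hd⟩ := hN.exists_realize hC Y (hYc.trans_lt hc) (fun y => (y.1 : C))
    (fun φ => (N.subtype.map_formula φ _).symm) c
  refine ⟨d, d.2, eqTp_iff.2 fun φ => ?_⟩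
  let f : B ⊕ Fin 1 → Y ⊕ Fin 1 := Sum.map (fun b => ⟨⟨b.1, hB b.2⟩, b.2⟩) id
  have := hd (φ.relabel f)
  rw [Language.Formula.realize_relabel, Language.Formula.realize_relabel,
    ← N.subtype.map_formula] at this
  convert this using 2
  · funext s
    rcases s with b | j <;> rfl
  · funext s
    rcases s with b | j <;> rfl

theorem typeOf_subtype (N : L.ElementarySubstructure C) {k : ℕ} (c : Fin k → N) :
    T.typeOf c = T.typeOf fun i => (c i : C) := by
  refine SetLike.ext fun φ => ?_
  rw [Language.Theory.CompleteType.mem_typeOf, Language.Theory.CompleteType.mem_typeOf]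
  exact (N.subtype.map_formula _ c).symm

/-- Types over a subset of an elementary substructure are types in the ambient model. -/
theorem exists_realize_of_mem_SD (hC : IsHomogeneous D χ C) {N : L.ElementarySubstructure C}
    {Y : Set N} (hY : #Y < χ) {p : Set (L.Formula (N ⊕ Fin 1))} (hp : p ∈ SD D Y 1) :
    ∃ c : C, ∀ φ ∈ p, φ.Realize (Sum.elim Subtype.val fun _ => c) := by
  let e : N ⊕ Fin 1 → C ⊕ Fin 1 := Sum.map Subtype.val id
  have he : ∀ c : Fin 1 → C, Sum.elim id c ∘ e = Sum.elim Subtype.val c := fun c => by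
    funext s
    rcases s with s | s <;> rfl
  let Z : Set C := Subtype.val '' Y
  have hsub : (fun φ => rename φ e) '' p ∈ SD D Z 1 := by
    refine ⟨⟨?_, ?_, ?_⟩, ?_⟩
    · rintro _ ⟨φ, hφ, rfl⟩
      obtain ⟨ψ, rfl⟩ := hp.1.subset_over hφ
      refine ⟨rename ψ (Sum.map (fun y => ⟨y.1.1, y.1, y.2, rfl⟩) id), ?_⟩
      simp only [rename_rename]
      congr 1
      funext s
      rcases s with s | s <;> rfl
    · rintro _ ⟨ψ, rfl⟩
      have hex : ∀ z : Z, ∃ y : Y, (y.1 : C) = z := by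
        rintro ⟨_, y, hy, rfl⟩
        exact ⟨⟨y, hy⟩, rfl⟩
      choose f hf using hex
      have heq : rename ψ (Sum.map Subtype.val id) =
          rename (rename (rename ψ (Sum.map f id)) (Sum.map Subtype.val id)) e := by
        simp only [rename_rename]
        congr 1
        funext s
        rcases s with s | s
        · exact congrArg Sum.inl (hf s).symm
        · rfl
      change rename ψ _ ∈ _ ∨ (rename ψ _).not ∈ _
      rw [heq]
      rcases hp.1.complete _ ⟨rename ψ (Sum.map f id), rfl⟩ with h | h
      · exact Or.inl ⟨_, h, rfl⟩
      · exact Or.inr ⟨_, h, rfl⟩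
    · intro s hs hfin
      obtain ⟨s', hs', hs'fin, rfl⟩ := (Set.exists_subset_image_finite_and
        (p := fun t => t = s)).1 ⟨s, hs, hfin, rfl⟩
      obtain ⟨d, hd⟩ := hp.1.finitely_satisfiable s' hs' hs'fin
      refine ⟨fun i => d i, ?_⟩
      rintro _ ⟨φ, hφ, rfl⟩
      rw [realize_rename, he]
      have := (N.subtype.map_formula φ _).2 (hd φ hφ)
      convert this using 1
      funext s
      rcases s with s | s <;> rfl
    · intro k t ht
      have hex : ∀ i, ∃ s : N ⊕ Fin 1, t i = e s ∧ ∀ a, s = Sum.inl a → a ∈ Y := by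
        intro i
        rcases h : t i with a | j
        · obtain ⟨y, hy, rfl⟩ := ht i a h
          refine ⟨Sum.inl y, rfl, ?_⟩
          rintro _ ⟨⟩
          exact hy
        · refine ⟨Sum.inr j, rfl, ?_⟩
          rintro _ ⟨⟩
      choose s hs hs' using hex
      obtain ⟨q, hq, hqp⟩ := hp.2 k s hs'
      refine ⟨q, hq, ?_⟩
      rintro _ ⟨φ, hφ, rfl⟩
      refine ⟨rename φ s, hqp ⟨φ, hφ, rfl⟩, ?_⟩
      simp only [rename_rename]
      rw [show t = e ∘ s from funext hs]
  obtain ⟨c, hc⟩ := hC.2 Z (mk_image_le.trans_lt hY) _ hsub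
  refine ⟨c 0, fun φ hφ => ?_⟩
  have := hc _ ⟨φ, hφ, rfl⟩
  rw [realize_rename, he] at this
  convert this using 2
  funext i
  rw [Subsingleton.elim i 0]

/-- A type over a small subset of `N` is realized first in `C`, which needs `lam ≤ χ`, and the
realization is then replaced by one in `N`. -/
theorem RealizesSmall.isHomogeneous (hC : IsHomogeneous D χ C) {lam : Cardinal.{u}} (hl : lam ≤ χ)
    {N : L.ElementarySubstructure C} (hN : RealizesSmall L lam (N : Set C)) :
    IsHomogeneous D lam N := by
  refine ⟨fun k c => ?_, fun Y hY p hp => ?_⟩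
  · rw [typeOf_subtype]
    exact hC.1 _ _
  · obtain ⟨c, hc⟩ := exists_realize_of_mem_SD hC (hY.trans_le hl) hp
    obtain ⟨d, hd, hcd⟩ := hN (Subtype.val '' Y) (by rintro _ ⟨y, -, rfl⟩; exact y.2)
      (mk_image_le.trans_lt hY) c
    refine ⟨fun _ => ⟨d, hd⟩, fun φ hφ => ?_⟩
    have h1 := hc φ hφ
    obtain ⟨ψ, rfl⟩ := hp.1.subset_over hφ
    rw [← N.subtype.map_formula]
    simp only [realize_rename] at h1 ⊢
    refine (hcd.realize_iff _ _ ?_ ψ).1 h1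
    rintro (y | i)
    · exact Or.inl ⟨y.1, ⟨y.1, y.2, rfl⟩, rfl⟩
    · exact Or.inr ⟨i, rfl⟩

theorem tp_mem_SD (hC : IsDModel D C) (A : Set C) {n : ℕ} (c : Fin n → C) :
    tp L c A ∈ SD D A n := by
  refine ⟨⟨fun φ h => h.1, ?_, fun s hs _ => ⟨c, fun φ hφ => (hs hφ).2⟩⟩, ?_⟩
  · rintro _ ⟨ψ, rfl⟩
    by_cases h : (rename ψ (Sum.map Subtype.val id)).Realize (Sum.elim id c)
    · exact Or.inl ⟨⟨ψ, rfl⟩, h⟩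
    · exact Or.inr ⟨⟨ψ.not, rfl⟩, h⟩
  · intro k t ht
    have hex : ∀ i, ∃ s : A ⊕ Fin n, t i = Sum.map Subtype.val id s := by
      intro i
      rcases h : t i with a | j
      · exact ⟨Sum.inl ⟨a, ht i a h⟩, rfl⟩
      · exact ⟨Sum.inr j, rfl⟩
    choose s hs using hex
    refine ⟨T.typeOf fun i => Sum.elim id c (t i), hC _ _, ?_⟩
    rintro _ ⟨φ, hφ, rfl⟩
    rw [Language.Theory.CompleteType.formula_mem_typeOf] at hφ
    refine ⟨⟨rename φ s, ?_⟩, ?_⟩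
    · simp only [rename_rename]
      rw [show t = Sum.map Subtype.val id ∘ s from funext hs]
    · rw [realize_rename]
      exact hφ

variable (L) in
/-- Over `X`, the type of `c` is determined by its restriction to `B`. -/
def Determines (B X : Set C) (c : C) : Prop :=
  ∀ c' : C, EqTp L B (fun _ : Fin 1 => c') (fun _ => c) → EqTp L X (fun _ : Fin 1 => c') (fun _ => c)

/-- Since `#A < χ`, every competitor `q` is the type of an element of `C`, so isolation can be
tested on elements. -/
theorem Determines.isIsolatedOver (hC : IsHomogeneous D χ C) {lam : Cardinal.{u}} {A B : Set C}
    {c : C} (hA : #A < χ) (hBA : B ⊆ A) (hB : #B < lam) (h : Determines L B A c) :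
    IsIsolatedOver D lam A B (tp L (fun _ => c) A) := by
  refine ⟨tp_mem_SD hC.1 A _, hBA, hB, fun q hq hsub => ?_⟩
  obtain ⟨d, hd⟩ := hC.2 A hA q hq
  have hd' : d = fun _ => d 0 := funext fun i => by rw [Subsingleton.elim i 0]
  rw [eq_tp_of_realizes hq.1 hd, tp_eq_iff, hd']
  refine h _ ?_
  rw [← hd', EqTp.eq_1]
  refine (tp_eq_iff.1 ?_ : EqTp L B d _)
  symm
  refine eq_tp_of_realizes (tp_mem_SD hC.1 B _).1 fun φ hφ => ?_
  exact hd φ (hsub ⟨⟨formulasOver_mono hBA 1 hφ.1, hφ.2⟩, hφ.1⟩)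

theorem typeOf_eq_iff {k : ℕ} {c d : Fin k → C} :
    T.typeOf c = T.typeOf d ↔ ∀ φ : L.Formula (Fin k), φ.Realize c ↔ φ.Realize d := by
  constructor
  · intro h φ
    rw [← Language.Theory.CompleteType.formula_mem_typeOf (T := T), h,
      Language.Theory.CompleteType.formula_mem_typeOf]
  · intro h
    refine SetLike.ext fun φ => ?_
    rw [Language.Theory.CompleteType.mem_typeOf, Language.Theory.CompleteType.mem_typeOf]
    exact h _

end Homogeneity

/-! ### A rank on realized types over finite sets -/

section TupleRank

variable (L : FirstOrder.Language.{u, u}) {C : Type u} [L.Structure C]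

/-- A rank for the types over finite subsets `F` of `A` realized by tuples `c`; it is bounded by
the rank `R_A[tp(c, F)]`. -/
def TupleRankGE (A : Set C) {n : ℕ} (α : Ordinal.{u}) (c : Fin n → C) (F : Set C) : Prop :=
  -- Quantifying over all `β < α` merges the zero, successor and limit clauses. In place of a
  -- splitting formula there are two realizations of the type over `F` that differ over `G`.
  ∀ β : Ordinal.{u}, β < α →
    (∃ G ⊆ A, G.Finite ∧ ∃ c₁ c₂ : Fin n → C, EqTp L F c c₁ ∧ EqTp L F c c₂ ∧
      ¬ EqTp L G c₁ c₂ ∧ TupleRankGE A β c₁ (F ∪ G) ∧ TupleRankGE A β c₂ (F ∪ G)) ∧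
    (∀ G ⊆ A, G.Finite → ∃ c₁ : Fin n → C, EqTp L F c c₁ ∧ TupleRankGE A β c₁ (F ∪ G))
termination_by α

/-- No tuple has unbounded rank over a finite subset of `A`. -/
def BoundedTupleRank (C : Type u) [L.Structure C] : Prop :=
  ∀ (A : Set C) (n : ℕ) (c : Fin n → C) (F : Set C), F ⊆ A → F.Finite →
    ∃ α : Ordinal.{u}, ¬ TupleRankGE L A α c F

variable {L}

theorem TupleRankGE.anti {A : Set C} {n : ℕ} {α β : Ordinal.{u}} {c : Fin n → C} {F : Set C}
    (h : TupleRankGE L A α c F) (hle : β ≤ α) : TupleRankGE L A β c F := by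
  rw [TupleRankGE] at h ⊢
  exact fun γ hγ => h γ (hγ.trans_le hle)

theorem TupleRankGE.mono {A : Set C} {n : ℕ} {α : Ordinal.{u}} {c : Fin n → C} {F F' : Set C}
    (h : TupleRankGE L A α c F') (hF : F ⊆ F') (hF'A : F' ⊆ A) (hF' : F'.Finite) :
    TupleRankGE L A α c F := by
  induction α using WellFoundedLT.induction generalizing c F F' with
  | _ α ih =>
    rw [TupleRankGE] at h ⊢
    intro β hβ
    obtain ⟨⟨G, hG, hGf, c₁, c₂, h₁, h₂, h₃, h₄, h₅⟩, h₆⟩ := h β hβ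
    refine ⟨⟨G, hG, hGf, c₁, c₂, h₁.mono hF, h₂.mono hF, h₃, ?_, ?_⟩, fun G hG hGf => ?_⟩
    · exact ih β hβ h₄ (Set.union_subset_union_left _ hF) (Set.union_subset hF'A hG) (hF'.union hGf)
    · exact ih β hβ h₅ (Set.union_subset_union_left _ hF) (Set.union_subset hF'A hG) (hF'.union hGf)
    · obtain ⟨c₁, h₁, h₂⟩ := h₆ G hG hGf
      exact ⟨c₁, h₁.mono hF, ih β hβ h₂ (Set.union_subset_union_left _ hF)
        (Set.union_subset hF'A hG) (hF'.union hGf)⟩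

/-- A member of minimal rank of a family of pairs `(c, F)`: the rank condition fails at some level
at which all members of the family have at least that rank. -/
theorem BoundedTupleRank.exists_minimal (hb : BoundedTupleRank L C) (A : Set C) {n : ℕ}
    (P : (Fin n → C) → Set C → Prop) (hP : ∃ c F, P c F)
    (hPF : ∀ c F, P c F → F ⊆ A ∧ F.Finite) :
    ∃ (β : Ordinal.{u}) (c : Fin n → C) (F : Set C), P c F ∧
      ¬ TupleRankGE L A (β + 1) c F ∧ ∀ c' F', P c' F' → TupleRankGE L A β c' F' := by
  let S : Set Ordinal.{u} := {α | ∃ c F, P c F ∧ ¬ TupleRankGE L A α c F}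
  have hS : S.Nonempty := by
    obtain ⟨c, F, h⟩ := hP
    obtain ⟨α, hα⟩ := hb A n c F (hPF c F h).1 (hPF c F h).2
    exact ⟨α, c, F, h, hα⟩
  obtain ⟨c, F, h, hα⟩ := csInf_mem hS
  have hmin : ∀ β < sInf S, ∀ c' F', P c' F' → TupleRankGE L A β c' F' := by
    intro β hβ c' F' h'
    by_contra hn
    exact notMem_of_lt_csInf' hβ ⟨c', F', h', hn⟩
  have hα' := hα
  rw [TupleRankGE] at hα'
  push Not at hα'
  obtain ⟨β, hβ, hfail⟩ := hα'
  -- The clause for this `β < sInf S` already fails, hence so does rank `β + 1`; minimality of `sInf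
  -- S` gives every member rank at least `β`.
  refine ⟨β, c, F, h, fun hc => ?_, hmin β hβ⟩
  rw [TupleRankGE] at hc
  obtain ⟨h₁, h₂⟩ := hc β (lt_add_one β)
  obtain ⟨G, hG, hGf, h₃⟩ := hfail h₁
  obtain ⟨c₁, h₄, h₅⟩ := h₂ G hG hGf
  exact h₃ c₁ h₄ h₅

theorem eqTp_of_forall_finite {X : Set C} {n : ℕ} {c d : Fin n → C}
    (h : ∀ G ⊆ X, G.Finite → EqTp L G c d) : EqTp L X c d := by
  refine isElem_of_finite fun Δ hΔ hfin => ?_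
  refine IsElem.mono (h (X ∩ Prod.fst '' Δ) Set.inter_subset_left
    ((hfin.image _).subset Set.inter_subset_right)) fun z hz => ?_
  rcases hΔ hz with h' | h'
  · exact Or.inl (mem_diag.2 ⟨⟨(mem_diag.1 h').1, z, hz, rfl⟩, (mem_diag.1 h').2⟩)
  · exact Or.inr h'

/-- A type over `F` of rank `β` has at most one extension to `A` all of whose restrictions have
rank at least `β`. -/
theorem eqTp_of_not_tupleRankGE_succ {A : Set C} {n : ℕ} {β : Ordinal.{u}} {c d : Fin n → C}
    {F : Set C} (hF : ¬ TupleRankGE L A (β + 1) c F)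
    (hc : ∀ G ⊆ A, G.Finite → TupleRankGE L A β c (F ∪ G))
    (hd : ∀ G ⊆ A, G.Finite → TupleRankGE L A β d (F ∪ G)) (hcd : EqTp L F c d) :
    EqTp L A c d := by
  by_contra hn
  have : ∃ G ⊆ A, G.Finite ∧ ¬ EqTp L G c d := by
    by_contra hG
    push Not at hG
    exact hn (eqTp_of_forall_finite hG)
  obtain ⟨G, hG, hGf, hne⟩ := this
  apply hF
  rw [TupleRankGE]
  intro γ hγ
  have hγ' := Order.lt_add_one_iff.1 hγ
  exact ⟨⟨G, hG, hGf, c, d, EqTp.refl _ _, hcd, hne, (hc G hG hGf).anti hγ', (hd G hG hGf).anti hγ'⟩,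
    fun G hG hGf => ⟨c, EqTp.refl _ _, (hc G hG hGf).anti hγ'⟩⟩

end TupleRank

/-! ### Comparison with the rank `R_A` -/

section RankBound

variable {L : FirstOrder.Language.{u, u}} {T : L.Theory} {D : Diagram T}
variable {C : Type u} [L.Structure C]

theorem rankGEFin_zero {A : Set C} {n : ℕ} {p : Set (L.Formula (C ⊕ Fin n))} :
    RankGEFin D A 0 p ↔ ∃ c : Fin n → C, Realizes c p := by
  rw [RankGEFin, Ordinal.limitRecOn_zero]

theorem rankGEFin_add_one {A : Set C} {n : ℕ} {α : Ordinal.{u}} {p : Set (L.Formula (C ⊕ Fin n))} :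
    RankGEFin D A (α + 1) p ↔
      (∃ φ ∈ formulasOver L A n, RankGEFin D A α (p ∪ {φ}) ∧ RankGEFin D A α (p ∪ {φ.not})) ∧
      (∀ (m : ℕ) (a : Fin m → C), (∀ j, a j ∈ A) →
        ∃ q : T.CompleteType (Fin (n + m)),
          (⟨n + m, q⟩ : Σ n : ℕ, T.CompleteType (Fin n)) ∈ D ∧
          RankGEFin D A α
            (p ∪ instType q (Fin.addCases (fun i => Sum.inr i) (fun j => Sum.inl (a j))))) := by
  rw [RankGEFin, Ordinal.limitRecOn_add_one]
  rfl

theorem rankGEFin_limit {A : Set C} {n : ℕ} {α : Ordinal.{u}} (hα : Order.IsSuccLimit α)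
    {p : Set (L.Formula (C ⊕ Fin n))} :
    RankGEFin D A α p ↔ ∀ β < α, RankGEFin D A β p := by
  rw [RankGEFin, Ordinal.limitRecOn_limit _ _ _ _ hα]
  rfl

theorem RankGEFin.mono {A : Set C} {n : ℕ} {α : Ordinal.{u}} {p p' : Set (L.Formula (C ⊕ Fin n))}
    (h : RankGEFin D A α p') (hp : p ⊆ p') : RankGEFin D A α p := by
  induction α using Ordinal.limitRecOn generalizing p p' with
  | zero =>
    rw [rankGEFin_zero] at h ⊢
    obtain ⟨c, hc⟩ := h
    exact ⟨c, fun φ hφ => hc φ (hp hφ)⟩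
  | add_one α ih =>
    rw [rankGEFin_add_one] at h ⊢
    obtain ⟨⟨φ, hφ, h₁, h₂⟩, h₃⟩ := h
    refine ⟨⟨φ, hφ, ih h₁ (Set.union_subset_union_left _ hp),
      ih h₂ (Set.union_subset_union_left _ hp)⟩, fun m a ha => ?_⟩
    obtain ⟨q, hq, h₄⟩ := h₃ m a ha
    exact ⟨q, hq, ih h₄ (Set.union_subset_union_left _ hp)⟩
  | limit α hα ih =>
    rw [rankGEFin_limit hα] at h ⊢
    exact fun β hβ => ih β hβ (h β hβ) hp

theorem tp_subset_tp_union {F G : Set C} {n : ℕ} {c d : Fin n → C} (h : EqTp L F c d) :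
    tp L c F ⊆ tp L d (F ∪ G) := by
  rw [tp_eq_iff.2 h]
  exact fun φ hφ => ⟨formulasOver_mono Set.subset_union_left n hφ.1, hφ.2⟩

variable [Nonempty C] [C ⊨ T]

/-- A formula separating `c₁` from `c₂` supplies clause (a) of `R_A`. For clause (b), the type of
the concatenation of `c₁` and `a` over the empty set is in `D` because `C` is a `D`-model. -/
theorem TupleRankGE.rankGEFin (hC : IsDModel D C) {A : Set C} {n : ℕ} {α : Ordinal.{u}}
    {c : Fin n → C} {F : Set C} (hF : F ⊆ A) (h : TupleRankGE L A α c F) :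
    RankGEFin D A α (tp L c F) := by
  induction α using Ordinal.limitRecOn generalizing c F with
  | zero =>
    rw [rankGEFin_zero]
    exact ⟨c, fun φ hφ => hφ.2⟩
  | add_one α ih =>
    rw [rankGEFin_add_one]
    rw [TupleRankGE] at h
    obtain ⟨⟨G, hG, hGf, c₁, c₂, h₁, h₂, h₃, h₄, h₅⟩, h₆⟩ := h α (lt_add_one α)
    constructor
    · rw [eqTp_iff] at h₃
      push Not at h₃
      obtain ⟨ψ, hψ⟩ := h₃
      have key : ∀ (d d' : Fin n → C), EqTp L F c d → EqTp L F c d' →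
          TupleRankGE L A α d (F ∪ G) → TupleRankGE L A α d' (F ∪ G) →
          ψ.Realize (Sum.elim Subtype.val d) → ¬ ψ.Realize (Sum.elim Subtype.val d') →
          ∃ φ ∈ formulasOver L A n, RankGEFin D A α (tp L c F ∪ {φ}) ∧
            RankGEFin D A α (tp L c F ∪ {φ.not}) := by
        intro d d' hd hd' hr hr' hψd hψd'
        have hmem : ∀ (θ : L.Formula (G ⊕ Fin n)) (e : Fin n → C), EqTp L F c e →
            θ.Realize (Sum.elim Subtype.val e) →
            tp L c F ∪ {rename θ (Sum.map Subtype.val id)} ⊆ tp L e (F ∪ G) := by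
          intro θ e he hθ
          refine Set.union_subset (tp_subset_tp_union he) ?_
          rintro _ rfl
          exact ⟨formulasOver_mono Set.subset_union_right n ⟨θ, rfl⟩,
            (realize_sumMap_iff θ e).2 hθ⟩
        refine ⟨rename ψ (Sum.map Subtype.val id), formulasOver_mono hG n ⟨ψ, rfl⟩,
          (ih (Set.union_subset hF hG) hr).mono (hmem ψ d hd hψd),
          (ih (Set.union_subset hF hG) hr').mono (hmem ψ.not d' hd' hψd')⟩
      rcases hψ with ⟨hψ, hψ'⟩ | ⟨hψ, hψ'⟩
      · exact key c₁ c₂ h₁ h₂ h₄ h₅ hψ hψ'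
      · exact key c₂ c₁ h₂ h₁ h₅ h₄ hψ' hψ
    · intro m a ha
      obtain ⟨c₁, h₇, h₈⟩ := h₆ (Set.range a) (Set.range_subset_iff.2 ha) (Set.finite_range a)
      have hra : Set.range a ⊆ A := Set.range_subset_iff.2 ha
      refine ⟨T.typeOf (Fin.addCases c₁ a), hC _ _, ?_⟩
      refine (ih (Set.union_subset hF hra) h₈).mono
        (Set.union_subset (tp_subset_tp_union h₇) ?_)
      rintro _ ⟨φ, hφ, rfl⟩
      rw [Language.Theory.CompleteType.formula_mem_typeOf] at hφ
      refine ⟨formulasOver_mono Set.subset_union_right n ⟨rename φ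
        (Fin.addCases (fun i => Sum.inr i) (fun j => Sum.inl ⟨a j, j, rfl⟩)), ?_⟩, ?_⟩
      · simp only [rename_rename]
        congr 1
        funext i
        refine Fin.addCases (fun i => ?_) (fun j => ?_) i <;> simp
      · rw [realize_rename]
        convert hφ using 1
        funext i
        refine Fin.addCases (fun i => ?_) (fun j => ?_) i <;> simp
  | limit α hα ih =>
    rw [rankGEFin_limit hα]
    exact fun β hβ => ih β hβ hF (h.anti hβ.le)

theorem IsTotallyTranscendental.boundedTupleRank (hC : IsDModel D C)
    (htt : IsTotallyTranscendental D C) : BoundedTupleRank L C := by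
  intro A n c F hF _
  obtain ⟨α, hα⟩ := htt A n (tp L c F) fun φ hφ => formulasOver_mono hF n hφ.1
  refine ⟨α, fun h => hα ?_⟩
  exact fun B _ _ q hq _ => (h.rankGEFin hC hF).mono hq

end RankBound

/-! ### Back and forth with finite elementary maps -/

section Extension

variable {L : FirstOrder.Language.{u, u}} {C : Type u} [L.Structure C] {χ : Cardinal.{u}}

theorem exists_extension_of_finite {X : Set C} {P : Set (C × C) → Prop}
    (h : ∀ Γ, P Γ → ∀ c ∈ X, ∃ d, P (insert (c, d) Γ)) {Γ : Set (C × C)} (hΓ : P Γ) {S : Set C}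
    (hS : S.Finite) (hSX : S ⊆ X) :
    ∃ Δ, P Δ ∧ Γ ⊆ Δ ∧ Prod.fst '' Δ = Prod.fst '' Γ ∪ S := by
  induction S, hS using Set.Finite.induction_on with
  | empty => exact ⟨Γ, hΓ, subset_rfl, by simp⟩
  | @insert a S ha hS ih =>
    obtain ⟨Δ, hΔ, hΓΔ, himg⟩ := ih fun x hx => hSX (Or.inr hx)
    obtain ⟨d, hd⟩ := h Δ hΔ a (hSX (Or.inl rfl))
    refine ⟨_, hd, hΓΔ.trans (Set.subset_insert _ _), ?_⟩
    rw [Set.image_insert_eq, himg, Set.union_insert]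

theorem ExtendsElem.exists_tuple (hE : ExtendsElem L C χ) (hχ : ℵ₀ ≤ χ) {Γ : Set (C × C)}
    (hΓ : IsElem L Γ) (hc : #Γ < χ) {ι : Type*} [Finite ι] (c : ι → C) :
    ∃ d : ι → C, IsElem L (Γ ∪ pairs c d) := by
  obtain ⟨Δ, hΔ, hΓΔ, himg⟩ := exists_extension_of_finite (X := Set.univ)
    (P := fun Γ => IsElem L Γ ∧ #Γ < χ) (by
      rintro Γ ⟨h1, h2⟩ c -
      obtain ⟨d, hd⟩ := hE Γ h1 h2 c
      exact ⟨d, hd, mk_insert_le.trans_lt (add_lt_of_lt hχ h2 (one_lt_aleph0.trans_le hχ))⟩)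
    ⟨hΓ, hc⟩ (Set.finite_range c) (Set.subset_univ _)
  have hex : ∀ i, ∃ d, (c i, d) ∈ Δ := by
    intro i
    have : c i ∈ Prod.fst '' Δ := himg ▸ Or.inr ⟨i, rfl⟩
    obtain ⟨⟨x, d⟩, h, rfl⟩ := this
    exact ⟨d, h⟩
  choose d hd using hex
  refine ⟨d, hΔ.1.mono (Set.union_subset hΓΔ ?_)⟩
  rintro _ ⟨i, rfl⟩
  exact hd i

theorem ExtendsElem.exists_tuple_of_finite (hE : ExtendsElem L C χ) (hχ : ℵ₀ ≤ χ)
    {Γ : Set (C × C)} (hΓ : IsElem L Γ) (hf : Γ.Finite) {ι : Type*} [Finite ι] (c : ι → C) :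
    ∃ d : ι → C, IsElem L (Γ ∪ pairs c d) :=
  hE.exists_tuple hχ hΓ ((lt_aleph0_iff_set_finite.2 hf).trans_le hχ) c

/-- A finite elementary relation between elements of `X`. -/
structure IsFiniteElemOn (L : FirstOrder.Language.{u, u}) [L.Structure C] (X : Set C)
    (Γ : Set (C × C)) : Prop where
  isElem : IsElem L Γ
  finite : Γ.Finite
  subset : Γ ⊆ X ×ˢ X

theorem IsFiniteElemOn.inv {X : Set C} {Γ : Set (C × C)} (h : IsFiniteElemOn L X Γ) :
    IsFiniteElemOn L X (Prod.swap '' Γ) := by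
  refine ⟨h.isElem.inv ?_, h.finite.image _, ?_⟩
  · rintro _ ⟨z, hz, rfl⟩
    exact hz
  · rintro _ ⟨z, hz, rfl⟩
    exact ⟨(h.subset hz).2, (h.subset hz).1⟩

theorem IsFiniteElemOn.fst_subset {X : Set C} {Γ : Set (C × C)} (h : IsFiniteElemOn L X Γ) :
    Prod.fst '' Γ ⊆ X := by
  rintro _ ⟨z, hz, rfl⟩
  exact (h.subset hz).1

theorem IsFiniteElemOn.snd_subset {X : Set C} {Γ : Set (C × C)} (h : IsFiniteElemOn L X Γ) :
    Prod.snd '' Γ ⊆ X := by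
  rintro _ ⟨z, hz, rfl⟩
  exact (h.subset hz).2

/-- A relation `Γ` followed by an equality of types over its range. -/
theorem IsElem.trans_eqTp {ι : Type*} {Γ : Set (C × C)} {c d e : ι → C}
    (h : IsElem L (Γ ∪ pairs c d)) (h' : EqTp L (Prod.snd '' Γ) d e) :
    IsElem L (Γ ∪ pairs c e) := by
  refine IsElem.comp h h' ?_
  rintro z (hz | ⟨i, rfl⟩)
  · exact ⟨z.2, Or.inl hz, Or.inl ⟨z.2, ⟨z, hz, rfl⟩, rfl⟩⟩
  · exact ⟨d i, Or.inr ⟨i, rfl⟩, Or.inr ⟨i, rfl⟩⟩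

theorem EqTp.trans_isElem {ι : Type*} {Γ : Set (C × C)} {c d e : ι → C}
    (h' : EqTp L (Prod.fst '' Γ) c d) (h : IsElem L (Γ ∪ pairs d e)) :
    IsElem L (Γ ∪ pairs c e) := by
  refine IsElem.comp h' h ?_
  rintro z (hz | ⟨i, rfl⟩)
  · exact ⟨z.1, Or.inl ⟨z.1, ⟨z, hz, rfl⟩, rfl⟩, Or.inl hz⟩
  · exact ⟨d i, Or.inr ⟨i, rfl⟩, Or.inr ⟨i, rfl⟩⟩

theorem IsElem.eqTp_snd {ι : Type*} {Γ : Set (C × C)} {c c' d d' : ι → C}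
    (h : IsElem L (Γ ∪ pairs c d)) (h' : IsElem L (Γ ∪ pairs c' d'))
    (hc : EqTp L (Prod.fst '' Γ) c c') : EqTp L (Prod.snd '' Γ) d d' := by
  have h1 : IsElem L (Γ ∪ pairs c d') := hc.trans_isElem h'
  let Δ : Set (C × C) := {z | (z.2, z.1) ∈ Γ ∪ pairs c d}
  refine IsElem.comp (IsElem.inv (Θ := Δ) h fun z hz => hz) h1 ?_
  rintro z (hz | ⟨i, rfl⟩)
  · obtain ⟨⟨w, hw, h2⟩, h3⟩ := mem_diag.1 hz
    refine ⟨w.1, Or.inl ?_, Or.inl ?_⟩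
    · rw [← h2]; exact hw
    · rw [← h3, ← h2]; exact hw
  · exact ⟨c i, Or.inr ⟨i, rfl⟩, Or.inr ⟨i, rfl⟩⟩

theorem IsElem.eqTp_fst {ι : Type*} {Γ : Set (C × C)} {c c' d d' : ι → C}
    (h : IsElem L (Γ ∪ pairs c d)) (h' : IsElem L (Γ ∪ pairs c' d'))
    (hd : EqTp L (Prod.snd '' Γ) d d') : EqTp L (Prod.fst '' Γ) c c' := by
  have h1 : IsElem L (Γ ∪ pairs c d') := h.trans_eqTp hd
  let Δ : Set (C × C) := {z | (z.2, z.1) ∈ Γ ∪ pairs c' d'}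
  refine IsElem.comp h1 (IsElem.inv (Θ := Δ) h' fun z hz => hz) ?_
  rintro z (hz | ⟨i, rfl⟩)
  · obtain ⟨⟨w, hw, h2⟩, h3⟩ := mem_diag.1 hz
    refine ⟨w.2, Or.inl ?_, Or.inl ?_⟩
    · rw [← h2]; exact hw
    · rw [← h3, ← h2]; exact hw
  · exact ⟨d' i, Or.inr ⟨i, rfl⟩, Or.inr ⟨i, rfl⟩⟩

theorem IsElem.mono_left {ι : Type*} {Γ Δ : Set (C × C)} {c d : ι → C}
    (h : IsElem L (Δ ∪ pairs c d)) (hs : Γ ⊆ Δ) : IsElem L (Γ ∪ pairs c d) :=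
  h.mono (Set.union_subset_union_left _ hs)

/-- The image found in `C` is replaced by an element of `X` with the same type over the finite range
of `Γ`. This is the forth step inside `X`; the back step comes from the inverse map. -/
theorem RealizesSmall.extend (hE : ExtendsElem L C χ) (hχ : ℵ₀ ≤ χ) {X : Set C}
    (hX : RealizesSmall L ℵ₀ X) {Γ : Set (C × C)} (hΓ : IsFiniteElemOn L X Γ) {c : C}
    (hc : c ∈ X) : ∃ d, IsFiniteElemOn L X (insert (c, d) Γ) := by
  obtain ⟨d, hd⟩ := hE Γ hΓ.isElem ((lt_aleph0_iff_set_finite.2 hΓ.finite).trans_le hχ) c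
  obtain ⟨e, he, hde⟩ := hX (Prod.snd '' Γ) hΓ.snd_subset
    (lt_aleph0_iff_set_finite.2 (hΓ.finite.image _)) d
  refine ⟨e, ?_, hΓ.finite.insert _, Set.insert_subset ⟨hc, he⟩ hΓ.subset⟩
  rw [Set.insert_eq, Set.union_comm, ← pairs_const (ι := Fin 1)] at hd ⊢
  exact hd.trans_eqTp hde

theorem RealizesSmall.extend_fst (hE : ExtendsElem L C χ) (hχ : ℵ₀ ≤ χ) {X : Set C}
    (hX : RealizesSmall L ℵ₀ X) {Γ : Set (C × C)} (hΓ : IsFiniteElemOn L X Γ) {S : Set C}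
    (hS : S.Finite) (hSX : S ⊆ X) :
    ∃ Δ, IsFiniteElemOn L X Δ ∧ Γ ⊆ Δ ∧ Prod.fst '' Δ = Prod.fst '' Γ ∪ S :=
  exists_extension_of_finite (P := IsFiniteElemOn L X) (fun _ h _ hc => hX.extend hE hχ h hc) hΓ hS hSX

theorem RealizesSmall.extend_snd (hE : ExtendsElem L C χ) (hχ : ℵ₀ ≤ χ) {X : Set C}
    (hX : RealizesSmall L ℵ₀ X) {Γ : Set (C × C)} (hΓ : IsFiniteElemOn L X Γ) {S : Set C}
    (hS : S.Finite) (hSX : S ⊆ X) :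
    ∃ Δ, IsFiniteElemOn L X Δ ∧ Γ ⊆ Δ ∧ Prod.snd '' Δ = Prod.snd '' Γ ∪ S := by
  obtain ⟨Δ, h1, h2, h3⟩ := hX.extend_fst hE hχ hΓ.inv hS hSX
  refine ⟨Prod.swap '' Δ, h1.inv, fun z hz => ⟨z.swap, h2 ⟨z, hz, rfl⟩, rfl⟩, ?_⟩
  rw [Set.image_image] at h3 ⊢
  exact h3

end Extension

/-! ### Consequences of bounded rank: determined extensions, stability, nonsplitting -/

section RankConsequences

variable {L : FirstOrder.Language.{u, u}} {C : Type u} [L.Structure C] {χ : Cardinal.{u}}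

/-- Every type over a subset `B` of `X` has an extension to `X` which is determined by its
restriction to `B` together with a finite set. -/
theorem BoundedTupleRank.exists_determines (hb : BoundedTupleRank L C) {B X : Set C} (c : C) :
    ∃ (c' : C) (F : Set C), F ⊆ X ∧ F.Finite ∧ EqTp L B (fun _ : Fin 1 => c) (fun _ => c') ∧
      Determines L (B ∪ F) X c' := by
  -- The rank is minimized over all realizations `d` of `tp(c, B)` and all finite `F ⊆ X`. Anything
  -- with the type of `d` over `B ∪ F` is again such a realization, so it too keeps rank at least
  -- `β` over finite sets, and the extension of rank `β` is unique.
  obtain ⟨β, d, F, ⟨h1, h2, h3⟩, h4, h5⟩ := hb.exists_minimal X (n := 1)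
    (fun d F => EqTp L B (fun _ => c) d ∧ F ⊆ X ∧ F.Finite)
    ⟨fun _ => c, ∅, EqTp.refl _ _, Set.empty_subset _, Set.finite_empty⟩ (fun d F h => h.2)
  have hd : d = fun _ => d 0 := funext fun i => by rw [Subsingleton.elim i 0]
  rw [hd] at h1 h4
  refine ⟨d 0, F, h2, h3, h1, fun c' hc' => ?_⟩
  refine (eqTp_of_not_tupleRankGE_succ h4 (fun G hG hGf => h5 _ _ ⟨h1, Set.union_subset h2 hG,
    h3.union hGf⟩) (fun G hG hGf => h5 _ _ ⟨?_, Set.union_subset h2 hG, h3.union hGf⟩)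
    (hc'.mono Set.subset_union_right).symm).symm
  exact h1.trans (hc'.mono Set.subset_union_left).symm

theorem mk_finset_le (α : Type u) : #(Finset α) ≤ max ℵ₀ #α := by
  classical
  exact (mk_le_of_surjective (f := fun l : List α => l.toFinset) fun s =>
    ⟨s.toList, Finset.toList_toFinset s⟩).trans (mk_list_le_max α)

/-- Stability: over `X` there are at most `|X| + |D| + ℵ₀` types. -/
theorem BoundedTupleRank.exists_representatives {T : L.Theory} {D : Diagram T} [Nonempty C]
    [C ⊨ T] (hC : IsDModel D C) (hb : BoundedTupleRank L C) (X : Set C) :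
    ∃ R : Set C, #R ≤ #X + #D + ℵ₀ ∧
      ∀ c, ∃ r ∈ R, EqTp L X (fun _ : Fin 1 => c) (fun _ => r) := by
  have hex : ∀ c : C, ∃ (S : Finset X) (β : Ordinal.{u}),
      ¬ TupleRankGE L X (β + 1) (fun _ : Fin 1 => c) (Subtype.val '' (S : Set X)) ∧
      ∀ G ⊆ X, G.Finite → TupleRankGE L X β (fun _ : Fin 1 => c) G := by
    intro c
    obtain ⟨β, d, F, ⟨rfl, h2, h3⟩, h4, h5⟩ := hb.exists_minimal X (n := 1)
      (fun d F => d = (fun _ => c) ∧ F ⊆ X ∧ F.Finite)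
      ⟨fun _ => c, ∅, rfl, Set.empty_subset _, Set.finite_empty⟩ (fun d F h => h.2)
    have hfin : (Subtype.val ⁻¹' F : Set X).Finite := h3.preimage Subtype.val_injective.injOn
    refine ⟨hfin.toFinset, β, ?_, fun G hG hGf => h5 _ _ ⟨rfl, hG, hGf⟩⟩
    rwa [Set.Finite.coe_toFinset, Subtype.image_preimage_coe, Set.inter_eq_right.2 h2]
  choose S β h1 h2 using hex
  let t : ∀ (S : Finset X), C → Fin (S.card + 1) → C := fun S c =>
    Fin.cons c fun i => ((S.equivFin.symm i).1 : C)
  -- The type of `c` over `X` is coded by the finite set where its rank is least and the type over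
  -- the empty set of `c` followed by an enumeration of that set.
  let key : C → Finset X × D := fun c => (S c, ⟨⟨_, T.typeOf (t (S c) c)⟩, hC _ _⟩)
  have hkey : ∀ c d, key c = key d → EqTp L X (fun _ : Fin 1 => c) (fun _ => d) := by
    intro c d h
    have hS : S c = S d := congrArg Prod.fst h
    have h' : (⟨_, T.typeOf (t (S c) c)⟩ : Σ n : ℕ, T.CompleteType (Fin n)) =
        ⟨_, T.typeOf (t (S d) d)⟩ := congrArg (fun k => k.2.1) h
    rw [← hS] at h'
    have htp := typeOf_eq_iff.1 (eq_of_heq (Sigma.mk.inj h').2)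
    have hF : EqTp L (Subtype.val '' (S c : Set X)) (fun _ : Fin 1 => c) (fun _ => d) := by
      rw [eqTp_iff]
      intro φ
      have hex : ∀ s : ↥(Subtype.val '' (S c : Set X)) ⊕ Fin 1, ∃ i, ∀ e : C,
          Sum.elim Subtype.val (fun _ => e) s = t (S c) e i := by
        rintro (⟨_, x, hx, rfl⟩ | j)
        · refine ⟨((S c).equivFin ⟨x, hx⟩).succ, fun e => ?_⟩
          simp [t]
        · exact ⟨0, fun e => rfl⟩
      choose f hf using hex
      have := htp (φ.relabel f)
      rw [Language.Formula.realize_relabel, Language.Formula.realize_relabel] at this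
      convert this using 2
      · exact funext fun s => hf s c
      · exact funext fun s => hf s d
    have hsub : Subtype.val '' (S c : Set X) ⊆ X := by
      rintro _ ⟨x, -, rfl⟩
      exact x.2
    have hfin : (Subtype.val '' (S c : Set X)).Finite := (Finset.finite_toSet _).image _
    have hr : ∀ e : C, ∀ γ ≤ β e, ∀ G ⊆ X, G.Finite → TupleRankGE L X γ (fun _ : Fin 1 => e)
        (Subtype.val '' (S c : Set X) ∪ G) := fun e γ hγ G hG hGf =>
      (h2 e _ (Set.union_subset hsub hG) (hfin.union hGf)).anti hγ
    -- Equal codes do not presuppose equal ranks, so uniqueness is applied at the smaller of the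
    -- two.
    rcases le_total (β c) (β d) with hle | hle
    · exact eqTp_of_not_tupleRankGE_succ (h1 c) (hr c _ le_rfl) (hr d _ hle) hF
    · refine (eqTp_of_not_tupleRankGE_succ (h1 d) ?_ ?_ ?_).symm <;> rw [← hS]
      · exact hr d _ le_rfl
      · exact hr c _ hle
      · exact hF.symm
  refine ⟨Set.range fun k : Set.range key => k.2.choose, ?_, fun c => ?_⟩
  · refine mk_range_le.trans ((mk_set_le _).trans ?_)
    rw [mk_prod, lift_id, lift_id]
    refine (mul_le_max _ _).trans (max_le (max_le ((mk_finset_le X).trans (max_le ?_ ?_)) ?_) ?_)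
    · exact self_le_add_left _ _
    · rw [add_assoc]; exact self_le_add_right _ _
    · exact (self_le_add_left _ _).trans (self_le_add_right _ _)
    · exact self_le_add_left _ _
  · refine ⟨_, ⟨⟨key c, c, rfl⟩, rfl⟩, hkey _ _ ?_⟩
    exact (Exists.choose_spec (p := fun x => key x = key c) _).symm

/-- The witnesses move along `Γ` by back and forth inside `X`: the splitting clause needs `G` in the
domain, the other clause needs `G'` in the range. -/
theorem TupleRankGE.transfer (hE : ExtendsElem L C χ) (hχ : ℵ₀ ≤ χ) {X : Set C}
    (hX : RealizesSmall L ℵ₀ X) {n : ℕ} {α : Ordinal.{u}} {c d : Fin n → C} {Γ : Set (C × C)}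
    (hΓ : IsFiniteElemOn L X Γ) (hcd : IsElem L (Γ ∪ pairs c d))
    (h : TupleRankGE L X α c (Prod.fst '' Γ)) : TupleRankGE L X α d (Prod.snd '' Γ) := by
  induction α using WellFoundedLT.induction generalizing c d Γ with
  | _ α ih =>
    rw [TupleRankGE] at h ⊢
    intro β hβ
    obtain ⟨⟨G, hG, hGf, c₁, c₂, h₁, h₂, h₃, h₄, h₅⟩, h₆⟩ := h β hβ
    constructor
    · obtain ⟨Δ, hΔ, hΓΔ, himg⟩ := hX.extend_fst hE hχ hΓ hGf hG
      obtain ⟨d₁, hd₁⟩ := hE.exists_tuple_of_finite hχ hΔ.isElem hΔ.finite c₁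
      obtain ⟨d₂, hd₂⟩ := hE.exists_tuple_of_finite hχ hΔ.isElem hΔ.finite c₂
      have hs : Prod.snd '' Γ ∪ Prod.snd '' Δ = Prod.snd '' Δ :=
        Set.union_eq_right.2 (Set.image_mono hΓΔ)
      refine ⟨Prod.snd '' Δ, hΔ.snd_subset, hΔ.finite.image _, d₁, d₂,
        hcd.eqTp_snd (hd₁.mono_left hΓΔ) h₁,
        hcd.eqTp_snd (hd₂.mono_left hΓΔ) h₂, fun h => h₃ ?_, ?_, ?_⟩
      · refine (hd₁.eqTp_fst hd₂ h).mono ?_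
        rw [himg]
        exact Set.subset_union_right
      · rw [hs]
        exact ih β hβ hΔ hd₁ (himg ▸ h₄)
      · rw [hs]
        exact ih β hβ hΔ hd₂ (himg ▸ h₅)
    · intro G' hG' hG'f
      obtain ⟨Δ, hΔ, hΓΔ, himg⟩ := hX.extend_snd hE hχ hΓ hG'f hG'
      obtain ⟨e, he, he'⟩ := h₆ (Prod.fst '' Δ) hΔ.fst_subset (hΔ.finite.image _)
      rw [Set.union_eq_right.2 (Set.image_mono hΓΔ)] at he'
      obtain ⟨d₁, hd₁⟩ := hE.exists_tuple_of_finite hχ hΔ.isElem hΔ.finite e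
      refine ⟨d₁, hcd.eqTp_snd (hd₁.mono_left hΓΔ) he, ?_⟩
      rw [← himg]
      exact ih β hβ hΔ hd₁ he'

variable (L) in
/-- The type of `e` over `X` does not split over `F`. -/
def NonSplitting (F X : Set C) {ι : Type*} (e : ι → C) : Prop :=
  ∀ Γ, IsFiniteElemOn L X Γ → diag F ⊆ Γ → IsElem L (Γ ∪ pairs e e)

theorem NonSplitting.mono {F F' X : Set C} {ι : Type*} {e : ι → C} (h : NonSplitting L F X e)
    (hF : F ⊆ F') : NonSplitting L F' X e :=
  fun Γ hΓ hd => h Γ hΓ ((diag_mono hF).trans hd)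

/-- Let `F` minimize the rank of `e`. If some `Γ` fixing `F` violated nonsplitting, moving `e` along
`Γ` would give a tuple with the same type over `F`, of rank at least `β`, but differing from `e`
over the range of `Γ`. Then `e` would have rank `β + 1` over `F`. -/
theorem BoundedTupleRank.exists_nonSplitting (hb : BoundedTupleRank L C)
    (hE : ExtendsElem L C χ) (hχ : ℵ₀ ≤ χ) {X : Set C} (hX : RealizesSmall L ℵ₀ X) {n : ℕ}
    (e : Fin n → C) : ∃ F ⊆ X, F.Finite ∧ NonSplitting L F X e := by
  obtain ⟨β, d, F, ⟨rfl, h2, h3⟩, h4, h5⟩ := hb.exists_minimal X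
    (fun d F => d = e ∧ F ⊆ X ∧ F.Finite)
    ⟨e, ∅, rfl, Set.empty_subset _, Set.finite_empty⟩ (fun d F h => h.2)
  refine ⟨F, h2, h3, fun Γ hΓ hFΓ => ?_⟩
  obtain ⟨e', he'⟩ := hE.exists_tuple_of_finite hχ hΓ.isElem hΓ.finite d
  have hFd : F ⊆ Prod.fst '' Γ := fun x hx => ⟨(x, x), hFΓ ⟨x, hx, rfl⟩, rfl⟩
  have hFr : F ⊆ Prod.snd '' Γ := fun x hx => ⟨(x, x), hFΓ ⟨x, hx, rfl⟩, rfl⟩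
  have hee : EqTp L F d e' := he'.mono (Set.union_subset_union_left _ hFΓ)
  have hr : TupleRankGE L X β e' (Prod.snd '' Γ) :=
    TupleRankGE.transfer hE hχ hX hΓ he' (h5 _ _ ⟨rfl, hΓ.fst_subset, hΓ.finite.image _⟩)
  by_contra hn
  apply h4
  rw [TupleRankGE]
  intro γ hγ
  have hγ' := Order.lt_add_one_iff.1 hγ
  refine ⟨⟨Prod.snd '' Γ, hΓ.snd_subset, hΓ.finite.image _, d, e', EqTp.refl _ _, hee,
    fun h => hn (he'.trans_eqTp h.symm), ?_, ?_⟩, fun G hG hGf => ⟨d, EqTp.refl _ _, ?_⟩⟩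
  · exact (h5 _ _ ⟨rfl, Set.union_subset h2 hΓ.snd_subset, h3.union (hΓ.finite.image _)⟩).anti hγ'
  · rw [Set.union_eq_right.2 hFr]
    exact hr.anti hγ'
  · exact (h5 _ _ ⟨rfl, Set.union_subset h2 hG, h3.union hGf⟩).anti hγ'

/-- Types over the domain and the range of `Γ` of realizations of a type which does not split
correspond under `Γ`. -/
theorem NonSplitting.isElem {F X : Set C} {ι : Type*} {e c d : ι → C} (h : NonSplitting L F X e)
    {Γ : Set (C × C)} (hΓ : IsFiniteElemOn L X Γ) (hF : diag F ⊆ Γ)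
    (hc : EqTp L (Prod.fst '' Γ) c e) (hd : EqTp L (Prod.snd '' Γ) e d) :
    IsElem L (Γ ∪ pairs c d) :=
  (hc.trans_isElem (h Γ hΓ hF)).trans_eqTp hd

end RankConsequences

/-! ### Well-founded choice and finite sets of rationals -/

/-- Dependent choice along a well-founded relation, for conditions on a value which only involve
the preceding values. -/
theorem exists_forall_of_wellFoundedLT {ι β : Type*} [LT ι] [WellFoundedLT ι] [Nonempty β]
    (Q : ι → (ι → β) → β → Prop)
    (hQ : ∀ i f g, (∀ j < i, f j = g j) → ∀ v, Q i f v → Q i g v)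
    (hex : ∀ i f, (∀ j < i, Q j f (f j)) → ∃ v, Q i f v) : ∃ f : ι → β, ∀ i, Q i f (f i) := by
  classical
  let step : ∀ i : ι, (∀ j, j < i → β) → β := fun i g =>
    Classical.epsilon (Q i fun j => if h : j < i then g j h else Classical.arbitrary β)
  let f : ι → β := wellFounded_lt.fix step
  have hf : ∀ i, f i = Classical.epsilon
      (Q i fun j => if j < i then f j else Classical.arbitrary β) := fun i => by
    change wellFounded_lt.fix step i = _
    rw [WellFounded.fix_eq]
    rfl
  refine ⟨f, fun i => ?_⟩
  induction i using WellFoundedLT.induction with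
  | _ i ih =>
    have hcut : ∀ j < i, (if j < i then f j else Classical.arbitrary β) = f j :=
      fun j hj => if_pos hj
    obtain ⟨v, hv⟩ := hex i f ih
    have : ∃ v, Q i (fun j => if j < i then f j else Classical.arbitrary β) v :=
      ⟨v, hQ i _ _ (fun j hj => (hcut j hj).symm) v hv⟩
    rw [hf i]
    exact hQ i _ _ hcut _ (Classical.epsilon_spec this)

/-- With `exists_lt_forall_gt`, this supplies fresh points in a given cut of the rationals over a
finite set. -/
theorem exists_gt_forall_lt (U : Finset ℚ) (t : ℚ) : ∃ t' > t, ∀ s ∈ U, t < s → t' < s := by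
  induction U using Finset.induction_on with
  | empty => exact ⟨t + 1, by simp, by simp⟩
  | insert a U _ ih =>
    obtain ⟨t', ht', h⟩ := ih
    by_cases ha : t < a
    · obtain ⟨t'', h1, h2⟩ := exists_between (lt_min ht' ha)
      refine ⟨t'', h1, fun s hs hts => ?_⟩
      rcases Finset.mem_insert.1 hs with rfl | hs
      · exact h2.trans_le (min_le_right _ _)
      · exact (h2.trans_le (min_le_left _ _)).trans (h s hs hts)
    · refine ⟨t', ht', fun s hs hts => ?_⟩
      rcases Finset.mem_insert.1 hs with rfl | hs
      · exact absurd hts ha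
      · exact h s hs hts

theorem exists_lt_forall_gt (U : Finset ℚ) (t : ℚ) : ∃ t' < t, ∀ s ∈ U, s < t → s < t' := by
  obtain ⟨t', h1, h2⟩ := exists_gt_forall_lt (U.image Neg.neg) (-t)
  refine ⟨-t', by linarith, fun s hs hst => ?_⟩
  have := h2 (-s) (Finset.mem_image_of_mem _ hs) (by linarith)
  linarith

theorem exists_strictMonoOn_nat (S : Finset ℚ) : ∃ h : ℚ → ℕ, StrictMonoOn h S := by
  refine ⟨fun s => (S.filter (· < s)).card, fun a ha b _ hab => ?_⟩
  refine Finset.card_lt_card ⟨fun x hx => ?_, fun hsub => ?_⟩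
  · simp only [Finset.mem_filter] at hx ⊢
    exact ⟨hx.1, hx.2.trans hab⟩
  · have : a ∈ S.filter (· < a) := hsub (Finset.mem_filter.2 ⟨ha, hab⟩)
    exact lt_irrefl a (Finset.mem_filter.1 this).2

/-! ### Bounded rank excludes ordered indiscernible sequences -/

section Order

variable {L : FirstOrder.Language.{u, u}} {C : Type u} [L.Structure C] {χ : Cardinal.{u}}

/-- The pairs of corresponding entries of two families of tuples, over the indices in `S`. -/
def pairsOn {ι K : Type*} (S : Set ι) (x y : ι → K → C) : Set (C × C) :=
  {z | ∃ s ∈ S, ∃ k, z = (x s k, y s k)}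

theorem pairsOn_finite {ι K : Type*} [Finite K] {S : Set ι} (hS : S.Finite) (x y : ι → K → C) :
    (pairsOn S x y).Finite := by
  have : pairsOn S x y = ⋃ s ∈ S, Set.range fun k => (x s k, y s k) := by
    ext z
    simp only [pairsOn, Set.mem_iUnion, Set.mem_range, exists_prop, eq_comm]
    rfl
  rw [this]
  exact hS.biUnion fun s _ => Set.finite_range _

variable (L) in
/-- The sequence `u` of tuples is order-indiscernible over `F`. -/
def OrderIndiscernible (F : Set C) {K : Type*} (u : ℕ → K → C) : Prop :=
  ∀ (S : Finset ℚ) (h h' : ℚ → ℕ), StrictMonoOn h S → StrictMonoOn h' S →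
    IsElem L (diag F ∪ pairsOn S (fun s => u (h s)) fun s => u (h' s))

/-- The tuples are chosen along an enumeration `e` of the rationals by extending finite elementary
maps. Each choice is made for one increasing copy `h₀` in `ℕ`; indiscernibility transfers it to
every `h`, which keeps the recursion consistent. -/
theorem OrderIndiscernible.exists_rat (hE : ExtendsElem L C χ) (hχ : ℵ₀ ≤ χ) {F : Set C}
    (hF : F.Finite) {K : Type*} [Finite K] {u : ℕ → K → C} (hu : OrderIndiscernible L F u) :
    ∃ w : ℚ → K → C, ∀ (S : Finset ℚ) (h : ℚ → ℕ), StrictMonoOn h S →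
      IsElem L (diag F ∪ pairsOn S (fun s => u (h s)) w) := by
  let e : ℕ ≃ ℚ := (Denumerable.eqv ℚ).symm
  have himg : ∀ n, (((Finset.range (n + 1)).image e : Finset ℚ) : Set ℚ) = e '' Set.Iic n := by
    intro n
    ext s
    simp
  have : Nonempty (K → C) := ⟨u 0⟩
  obtain ⟨f, hf⟩ := exists_forall_of_wellFoundedLT (ι := ℕ) (β := K → C)
    (fun n f v => ∀ h : ℚ → ℕ, StrictMonoOn h (e '' Set.Iic n) →
      IsElem L (diag F ∪ pairsOn (Set.Iio n) (fun j => u (h (e j))) f ∪ pairs (u (h (e n))) v))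
    (by
      intro n f g hfg v hv h hh
      refine (hv h hh).mono (Set.union_subset_union_left _ (Set.union_subset_union_right _ ?_))
      rintro _ ⟨j, hj, k, rfl⟩
      exact ⟨j, hj, k, by rw [hfg j hj]⟩)
    (by
      intro n f hprev
      have hbase : ∀ h : ℚ → ℕ, StrictMonoOn h (e '' Set.Iic n) →
          IsElem L (diag F ∪ pairsOn (Set.Iio n) (fun j => u (h (e j))) f) := by
        intro h hh
        rcases n with _ | m
        · refine (isElem_diag F).mono (Set.union_subset subset_rfl ?_)
          rintro _ ⟨j, hj, -⟩
          exact absurd hj (Nat.not_lt_zero j)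
        · refine (hprev m (Nat.lt_succ_self m) h
            (hh.mono (Set.image_mono (Set.Iic_subset_Iic.2 (Nat.le_succ m))))).mono
            (Set.union_subset (fun z hz => Or.inl (Or.inl hz)) ?_)
          rintro _ ⟨j, hj, k, rfl⟩
          rcases Nat.lt_succ_iff_lt_or_eq.1 hj with hj | rfl
          · exact Or.inl (Or.inr ⟨j, hj, k, rfl⟩)
          · exact Or.inr ⟨k, rfl⟩
      obtain ⟨h₀, hh₀⟩ := exists_strictMonoOn_nat ((Finset.range (n + 1)).image e)
      have hh₀' := hh₀
      rw [himg] at hh₀'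
      obtain ⟨v, hv⟩ := hE.exists_tuple_of_finite hχ (hbase h₀ hh₀')
        ((hF.image _).union (pairsOn_finite (Set.finite_Iio n) _ _)) (u (h₀ (e n)))
      refine ⟨v, fun h hh => IsElem.comp (hu _ h h₀ (by rwa [himg]) hh₀) hv ?_⟩
      rintro z ((hz | ⟨j, hj, k, rfl⟩) | ⟨k, rfl⟩)
      · exact ⟨z.1, Or.inl (mem_diag.2 ⟨(mem_diag.1 hz).1, rfl⟩), Or.inl (Or.inl hz)⟩
      · refine ⟨u (h₀ (e j)) k, Or.inr ⟨e j, ?_, k, rfl⟩, Or.inl (Or.inr ⟨j, hj, k, rfl⟩)⟩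
        rw [himg]
        exact ⟨j, Set.mem_Iic.2 (le_of_lt hj), rfl⟩
      · refine ⟨u (h₀ (e n)) k, Or.inr ⟨e n, ?_, k, rfl⟩, Or.inr ⟨k, rfl⟩⟩
        rw [himg]
        exact ⟨n, Set.mem_Iic.2 le_rfl, rfl⟩)
  refine ⟨fun s => f (e.symm s), fun S h hh => ?_⟩
  obtain ⟨n, hn⟩ := (S.image e.symm).exists_le
  obtain ⟨h₀, hh₀⟩ := exists_strictMonoOn_nat ((Finset.range (n + 1)).image e)
  have hh₀' := hh₀
  rw [himg] at hh₀'
  have hSn : ∀ s ∈ S, e.symm s ≤ n := fun s hs => hn _ (Finset.mem_image_of_mem _ hs)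
  have hS₀ : StrictMonoOn h₀ S := hh₀'.mono fun s hs => ⟨e.symm s, hSn s hs, e.apply_symm_apply s⟩
  refine IsElem.comp (hu S h h₀ hh hS₀) (hf n h₀ hh₀') ?_
  rintro z (hz | ⟨s, hs, k, rfl⟩)
  · exact ⟨z.1, Or.inl (mem_diag.2 ⟨(mem_diag.1 hz).1, rfl⟩), Or.inl (Or.inl hz)⟩
  · refine ⟨u (h₀ s) k, Or.inr ⟨s, hs, k, rfl⟩, ?_⟩
    rcases (hSn s hs).lt_or_eq with hlt | heq
    · exact Or.inl (Or.inr ⟨e.symm s, hlt, k, by simp⟩)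
    · exact Or.inr ⟨k, by simp [← heq]⟩

/-- In a bounded rank situation an order-indiscernible sequence cannot be ordered by a
formula. -/
theorem OrderIndiscernible.eqTp (hb : BoundedTupleRank L C) (hE : ExtendsElem L C χ)
    (hχ : ℵ₀ ≤ χ) {F : Set C} (hF : F.Finite) {K : Type*} [Finite K] {u : ℕ → K → C}
    (hu : OrderIndiscernible L F u) {ι κ : Type*} (a : ι → K) (b : κ → K) [Unique ι] :
    EqTp L F (Sum.elim (u 0 ∘ a) (u 1 ∘ b)) (Sum.elim (u 1 ∘ a) (u 0 ∘ b)) := by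
  by_contra hne
  obtain ⟨w, hw⟩ := hu.exists_rat hE hχ hF
  let W : Set ℚ → Set C := fun S => {x | ∃ s ∈ S, ∃ k, x = w s k}
  have hWfin : ∀ S : Finset ℚ, (W S).Finite := fun S => by
    refine ((pairsOn_finite S.finite_toSet w w).image Prod.fst).subset ?_
    rintro _ ⟨s, hs, k, rfl⟩
    exact ⟨_, ⟨s, hs, k, rfl⟩, rfl⟩
  -- Indices in the same cut over `S` can be sent to the same place by increasing maps to `ℕ`.
  have hgap : ∀ (S : Finset ℚ) (t t' : ℚ), t ∉ S → t' ∉ S → (∀ s ∈ S, s < t ↔ s < t') →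
      EqTp L (F ∪ W S) (w t) (w t') := by
    intro S t t' ht ht' htt'
    obtain ⟨h, hh⟩ := exists_strictMonoOn_nat (insert t S)
    have hmem : ∀ s ∈ S, s ∈ (↑(insert t S) : Set ℚ) := fun s hs => by
      simpa using Or.inr hs
    have htm : t ∈ (↑(insert t S) : Set ℚ) := by simp
    let h' : ℚ → ℕ := fun s => if s = t' then h t else h s
    have h't : h' t' = h t := if_pos rfl
    have h's : ∀ s ∈ S, h' s = h s := fun s hs =>
      if_neg fun he : s = t' => ht' (he ▸ hs)
    have hh' : StrictMonoOn h' (↑(insert t' S) : Set ℚ) := by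
      intro x hx y hy hxy
      rcases Finset.mem_insert.1 hx with hx | hx <;> rcases Finset.mem_insert.1 hy with hy | hy
      · exact absurd hxy (hx ▸ hy ▸ lt_irrefl _)
      · rw [hx, h't, h's y hy]
        rw [hx] at hxy
        refine hh htm (hmem y hy) (lt_of_le_of_ne (not_lt.1 fun hlt => ?_)
          fun he => ht (he ▸ hy))
        exact lt_asymm hxy ((htt' y hy).1 hlt)
      · rw [hy, h't, h's x hx]
        rw [hy] at hxy
        exact hh (hmem x hx) htm ((htt' x hx).2 hxy)
      · rw [h's x hx, h's y hy]
        exact hh (hmem x hx) (hmem y hy) hxy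
    have h1 := hw _ h hh
    have h2 := hw _ h' hh'
    let Δ : Set (C × C) :=
      {z | (z.2, z.1) ∈ diag F ∪ pairsOn (↑(insert t S) : Set ℚ) (fun s => u (h s)) w}
    refine IsElem.comp (IsElem.inv (Θ := Δ) h1 fun z hz => hz) h2 ?_
    rintro z (hz | ⟨k, rfl⟩)
    · obtain ⟨hz1, hz2⟩ := mem_diag.1 hz
      rcases hz1 with hz1 | ⟨s, hs, k, hk⟩
      · exact ⟨z.1, Or.inl (mem_diag.2 ⟨hz1, rfl⟩), Or.inl (mem_diag.2 ⟨hz1, hz2⟩)⟩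
      · refine ⟨u (h s) k, Or.inr ⟨s, hmem s hs, k, by rw [← hk]⟩,
          Or.inr ⟨s, by simpa using Or.inr hs, k, ?_⟩⟩
        simp only [h's s hs, ← hk, hz2]
    · refine ⟨u (h t) k, Or.inr ⟨t, htm, k, rfl⟩, Or.inr ⟨t', by simp, k, ?_⟩⟩
      simp only [h't]
  have hord : ∀ s t : ℚ, s < t → ∀ {ι' : Type _} (f : ι' → K ⊕ K),
      EqTp L F (Sum.elim (u 0) (u 1) ∘ f) (Sum.elim (w s) (w t) ∘ f) := by
    intro s t hst ι' f
    have hh : StrictMonoOn (fun x => if x = s then 0 else 1) (↑({s, t} : Finset ℚ) : Set ℚ) := by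
      intro x hx y hy hxy
      simp only [Finset.coe_insert, Finset.coe_singleton, Set.mem_insert_iff,
        Set.mem_singleton_iff] at hx hy
      rcases hx with rfl | rfl <;> rcases hy with rfl | rfl
      · exact absurd hxy (lt_irrefl _)
      · simp [hst.ne']
      · exact absurd hxy (lt_asymm hst)
      · exact absurd hxy (lt_irrefl _)
    refine (hw _ _ hh).mono (Set.union_subset_union_right _ ?_)
    rintro _ ⟨i, rfl⟩
    dsimp only [Function.comp_apply]
    rcases f i with k | k
    · exact ⟨s, by simp, k, by simp⟩
    · exact ⟨t, by simp, k, by simp [hst.ne']⟩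
  -- The assumed asymmetry lets the tuple at `t` tell indices below `t` from indices above it.
  have hdiff : ∀ s t r : ℚ, s < t → t < r →
      ¬ EqTp L (F ∪ W {t}) (w s ∘ a) (w r ∘ a) := by
    intro s t r hst htr h
    apply hne
    have h1 := hord s t hst (Sum.map a b)
    have h2 := hord t r htr (Sum.elim (Sum.inr ∘ a) (Sum.inl ∘ b))
    rw [Sum.elim_comp_map] at h1
    have h3 : Sum.elim (u 0) (u 1) ∘ Sum.elim (Sum.inr ∘ a) (Sum.inl ∘ b) =
        Sum.elim (u 1 ∘ a) (u 0 ∘ b) := by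
      funext x; rcases x with x | x <;> rfl
    have h4 : Sum.elim (w t) (w r) ∘ Sum.elim (Sum.inr ∘ a) (Sum.inl ∘ b) =
        Sum.elim (w r ∘ a) (w t ∘ b) := by
      funext x; rcases x with x | x <;> rfl
    rw [h3, h4] at h2
    refine (h1.trans ?_).trans h2.symm
    refine IsElem.mono h ?_
    rintro z (hz | ⟨i | j, rfl⟩)
    · exact Or.inl (diag_mono Set.subset_union_left hz)
    · exact Or.inr ⟨i, rfl⟩
    · exact Or.inl (mem_diag.2 ⟨Or.inr ⟨t, rfl, b j, rfl⟩, rfl⟩)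
  have hcst : ∀ t, w t ∘ a = fun _ => w t (a default) := fun t => by
    funext i
    rw [Function.comp_apply, Unique.eq_default i]
  have hWA : ∀ S : Finset ℚ, F ∪ W S ⊆ F ∪ W Set.univ := fun S => by
    rintro x (hx | ⟨s, -, k, rfl⟩)
    · exact Or.inl hx
    · exact Or.inr ⟨s, trivial, k, rfl⟩
  have hWmono : ∀ S S' : Finset ℚ, S ⊆ S' → W S ⊆ W S' := by
    rintro S S' hSS' _ ⟨s, hs, k, rfl⟩
    exact ⟨s, hSS' hs, k, rfl⟩
  -- Every rank is attained: adding the tuple at `t` as parameters separates a point just below `t`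
  -- from one just above, both in the old cut over `S`. For the other clause, `t` moves within its
  -- cut away from the indices met by `G`.
  have hrank : ∀ (α : Ordinal.{u}) (S : Finset ℚ) (t : ℚ), t ∉ S →
      TupleRankGE L (F ∪ W Set.univ) α (fun _ : Fin 1 => w t (a default)) (F ∪ W S) := by
    intro α
    induction α using WellFoundedLT.induction with
    | _ α ih =>
      intro S t ht
      rw [TupleRankGE]
      intro β hβ
      have hup : ∀ U : Finset ℚ, ∃ t', t < t' ∧ t' ∉ S ∪ U ∧ (∀ s ∈ S, s < t ↔ s < t') := by
        intro U
        obtain ⟨t', h1, h2⟩ := exists_gt_forall_lt (S ∪ U) t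
        have hlt : ∀ s ∈ S ∪ U, s < t' → ¬ t < s := fun s hs h h' => lt_asymm h (h2 s hs h')
        refine ⟨t', h1, fun hm => lt_irrefl _ (h2 t' hm h1), fun s hs => ⟨fun h => h.trans h1,
          fun h => ?_⟩⟩
        exact lt_of_le_of_ne (not_lt.1 (hlt s (Finset.mem_union_left _ hs) h))
          fun h' => ht (h' ▸ hs)
      have hdown : ∃ t', t' < t ∧ t' ∉ S ∧ (∀ s ∈ S, s < t ↔ s < t') := by
        obtain ⟨t', h1, h2⟩ := exists_lt_forall_gt S t
        exact ⟨t', h1, fun hm => lt_irrefl _ (h2 t' hm h1), fun s hs => ⟨fun h => h2 s hs h,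
          fun h => h.trans h1⟩⟩
      have hgap' : ∀ t', t' ∉ S → (∀ s ∈ S, s < t ↔ s < t') →
          EqTp L (F ∪ W S) (fun _ : Fin 1 => w t (a default)) (fun _ => w t' (a default)) :=
        fun t' ht' h => (hgap S t t' ht ht' h).comp fun _ => a default
      have hSt : F ∪ W S ∪ (F ∪ W ({t} : Finset ℚ)) = F ∪ W (↑(insert t S) : Set ℚ) := by
        ext x
        constructor
        · rintro ((hx | ⟨s, hs, k, rfl⟩) | (hx | ⟨s, hs, k, rfl⟩))
          · exact Or.inl hx
          · exact Or.inr ⟨s, by simpa using Or.inr hs, k, rfl⟩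
          · exact Or.inl hx
          · exact Or.inr ⟨s, by simpa using Or.inl (by simpa using hs), k, rfl⟩
        · rintro (hx | ⟨s, hs, k, rfl⟩)
          · exact Or.inl (Or.inl hx)
          · rcases Finset.mem_insert.1 hs with rfl | hs
            · exact Or.inr (Or.inr ⟨s, by simp, k, rfl⟩)
            · exact Or.inl (Or.inr ⟨s, hs, k, rfl⟩)
      constructor
      · obtain ⟨r, hr1, hr2, hr3⟩ := hup ∅
        obtain ⟨s, hs1, hs2, hs3⟩ := hdown
        rw [Finset.union_empty] at hr2
        refine ⟨F ∪ W ({t} : Finset ℚ), hWA _, hF.union (hWfin _), fun _ => w s (a default),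
          fun _ => w r (a default), hgap' s hs2 hs3, hgap' r hr2 hr3, fun h => ?_, ?_, ?_⟩
        · apply hdiff s t r hs1 hr1
          rw [hcst, hcst]
          rw [Finset.coe_singleton] at h
          exact h.comp fun _ => 0
        · rw [hSt]
          exact ih β hβ _ _ (by simp [hs2, hs1.ne])
        · rw [hSt]
          exact ih β hβ _ _ (by simp [hr2, hr1.ne'])
      · intro G hG hGf
        have hcover : ∃ U : Finset ℚ, G ⊆ F ∪ W U := by
          clear ih
          induction G, hGf using Set.Finite.induction_on with
          | empty => exact ⟨∅, Set.empty_subset _⟩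
          | @insert x G _ _ ih =>
            obtain ⟨U, hU⟩ := ih fun y hy => hG (Or.inr hy)
            rcases hG (Or.inl rfl) with hx | ⟨s, -, k, rfl⟩
            · exact ⟨U, Set.insert_subset (Or.inl hx) hU⟩
            · refine ⟨insert s U, Set.insert_subset (Or.inr ⟨s, by simp, k, rfl⟩)
                (hU.trans (Set.union_subset_union_right _ (hWmono _ _ ?_)))⟩
              exact Finset.subset_insert _ _
        obtain ⟨U, hU⟩ := hcover
        obtain ⟨r, -, hr2, hr3⟩ := hup U
        refine ⟨fun _ => w r (a default),
          hgap' r (fun h => hr2 (Finset.mem_union_left _ h)) hr3, ?_⟩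
        refine (ih β hβ (S ∪ U) r hr2).mono (Set.union_subset ?_ ?_) (hWA _)
          (hF.union (hWfin _))
        · exact Set.union_subset_union_right _ (hWmono _ _ Finset.subset_union_left)
        · exact hU.trans (Set.union_subset_union_right _ (hWmono _ _ Finset.subset_union_right))
  obtain ⟨α, hα⟩ := hb (F ∪ W Set.univ) 1 (fun _ => w 0 (a default)) (F ∪ W (∅ : Finset ℚ))
    (hWA ∅) (hF.union (hWfin ∅))
  exact hα (hrank α ∅ 0 (Finset.notMem_empty _))

end Order

/-! ### Symmetry of nonsplitting types -/

section Commuting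

variable {L : FirstOrder.Language.{u, u}} {C : Type u} [L.Structure C] {χ : Cardinal.{u}}

theorem RealizesSmall.exists_tuple_mem (hE : ExtendsElem L C χ) (hχ : ℵ₀ ≤ χ) {Y : Set C}
    (hY : RealizesSmall L ℵ₀ Y) {B : Set C} (hB : B ⊆ Y) (hBf : B.Finite) {ι : Type*} [Finite ι]
    (c : ι → C) : ∃ d : ι → C, (∀ i, d i ∈ Y) ∧ EqTp L B d c := by
  obtain ⟨Δ, hΔ, hΓΔ, himg⟩ := exists_extension_of_finite (X := Set.univ)
    (P := fun Γ => IsElem L Γ ∧ Γ.Finite ∧ ∀ z ∈ Γ, z.2 ∈ Y) (by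
      rintro Γ ⟨h1, h2, h3⟩ c -
      obtain ⟨d, hd⟩ := hE Γ h1 ((lt_aleph0_iff_set_finite.2 h2).trans_le hχ) c
      obtain ⟨e, he, hde⟩ := hY (Prod.snd '' Γ) (by rintro _ ⟨z, hz, rfl⟩; exact h3 z hz)
        (lt_aleph0_iff_set_finite.2 (h2.image _)) d
      refine ⟨e, ?_, h2.insert _, ?_⟩
      · rw [Set.insert_eq, Set.union_comm, ← pairs_const (ι := Fin 1)] at hd ⊢
        exact hd.trans_eqTp hde
      · rintro z (rfl | hz)
        · exact he
        · exact h3 z hz)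
    ⟨isElem_diag B, hBf.image _, by rintro _ ⟨x, hx, rfl⟩; exact hB hx⟩ (Set.finite_range c)
    (Set.subset_univ _)
  have hex : ∀ i, ∃ d, (c i, d) ∈ Δ := by
    intro i
    have : c i ∈ Prod.fst '' Δ := himg ▸ Or.inr ⟨i, rfl⟩
    obtain ⟨⟨x, d⟩, h, rfl⟩ := this
    exact ⟨d, h⟩
  choose d hd using hex
  refine ⟨d, fun i => hΔ.2.2 _ (hd i), EqTp.symm (hΔ.1.mono (Set.union_subset hΓΔ ?_))⟩
  rintro _ ⟨i, rfl⟩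
  exact hd i

theorem EqTp.sumElim_right {F : Set C} {ι κ : Type*} {c d : ι → C} {b : κ → C}
    (h : EqTp L (F ∪ Set.range b) c d) : EqTp L F (Sum.elim c b) (Sum.elim d b) := by
  refine IsElem.mono h ?_
  rintro z (hz | ⟨i | j, rfl⟩)
  · exact Or.inl (diag_mono Set.subset_union_left hz)
  · exact Or.inr ⟨i, rfl⟩
  · exact Or.inl (mem_diag.2 ⟨Or.inr ⟨j, rfl⟩, rfl⟩)

theorem EqTp.sumElim_left {F : Set C} {ι κ : Type*} {c d : ι → C} {b : κ → C}
    (h : EqTp L (F ∪ Set.range b) c d) : EqTp L F (Sum.elim b c) (Sum.elim b d) := by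
  refine IsElem.mono h ?_
  rintro z (hz | ⟨i | j, rfl⟩)
  · exact Or.inl (diag_mono Set.subset_union_left hz)
  · exact Or.inl (mem_diag.2 ⟨Or.inr ⟨i, rfl⟩, rfl⟩)
  · exact Or.inr ⟨j, rfl⟩

theorem NonSplitting.sumElim_left {F X : Set C} {ι κ : Type*} [Finite κ] {c : ι → C} {b d : κ → C}
    (h : NonSplitting L F X c) (hF : F.Finite) (hFX : F ⊆ X) (hb : ∀ k, b k ∈ X)
    (hd : ∀ k, d k ∈ X) (hbd : EqTp L F b d) : EqTp L F (Sum.elim c b) (Sum.elim c d) := by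
  refine IsElem.mono (h _ ⟨hbd, (hF.image _).union (Set.finite_range _), ?_⟩
    Set.subset_union_left) ?_
  · rintro _ (⟨x, hx, rfl⟩ | ⟨k, rfl⟩)
    · exact ⟨hFX hx, hFX hx⟩
    · exact ⟨hb k, hd k⟩
  · rintro z (hz | ⟨i | j, rfl⟩)
    · exact Or.inl (Or.inl hz)
    · exact Or.inr ⟨i, rfl⟩
    · exact Or.inl (Or.inr ⟨j, rfl⟩)

theorem EqTp.sum_swap {F : Set C} {ι κ : Type*} {c d : ι → C} {b e : κ → C}
    (h : EqTp L F (Sum.elim c b) (Sum.elim d e)) : EqTp L F (Sum.elim b c) (Sum.elim e d) := by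
  have := h.comp (Sum.swap : κ ⊕ ι → ι ⊕ κ)
  rwa [Sum.elim_swap, Sum.elim_swap] at this

/-- Types which do not split over `F` commute: if `c'` in `Y` has the type of `c` over `F`, and
`b` realizes over `Y` a type that does not split over `F`, then `c'` realizes over `F ∪ b` the
nonsplitting extension `tp(c, F ∪ b)`. -/
theorem NonSplitting.eqTp_of_eqTp (hb : BoundedTupleRank L C) (hE : ExtendsElem L C χ)
    (hχ : ℵ₀ ≤ χ) {X Y F : Set C} (hYX : Y ⊆ X) (hY : RealizesSmall L ℵ₀ Y) (hF : F.Finite)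
    (hFY : F ⊆ Y) {c c' : C} {κ : Type*} [Finite κ] {b : κ → C} (hbX : ∀ k, b k ∈ X)
    (hc : NonSplitting L F X fun _ : Fin 1 => c) (hbY : NonSplitting L F Y b) (hc' : c' ∈ Y)
    (hcc' : EqTp L F (fun _ : Fin 1 => c') fun _ => c) :
    EqTp L F (Sum.elim (fun _ : Fin 1 => c') b) (Sum.elim (fun _ => c) b) := by
  let K := Fin 1 ⊕ κ
  let before : ℕ → (ℕ → K → C) → Set C := fun n f => {x | ∃ j < n, ∃ k, x = f j k}
  have hbefore : ∀ n f, (before n f).Finite := fun n f => by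
    refine ((pairsOn_finite (Set.finite_Iio n) f f).image Prod.fst).subset ?_
    rintro _ ⟨s, hs, k, rfl⟩
    exact ⟨_, ⟨s, hs, k, rfl⟩, rfl⟩
  have : Nonempty (K → C) := ⟨Sum.elim (fun _ => c) b⟩
  -- In `Y`, alternately copy `c` over `F` and all earlier entries, and `b` over these together with
  -- the new copy of `c`.
  obtain ⟨u, hu⟩ := exists_forall_of_wellFoundedLT (ι := ℕ) (β := K → C)
    (fun n f v => (∀ k, v k ∈ Y) ∧ EqTp L (F ∪ before n f) (v ∘ Sum.inl) (fun _ => c) ∧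
      EqTp L (F ∪ before n f ∪ Set.range (v ∘ Sum.inl)) (v ∘ Sum.inr) b)
    (by
      intro n f g hfg v hv
      have : before n f = before n g := by
        ext x
        constructor
        · rintro ⟨j, hj, k, rfl⟩
          exact ⟨j, hj, k, by rw [hfg j hj]⟩
        · rintro ⟨j, hj, k, rfl⟩
          exact ⟨j, hj, k, by rw [hfg j hj]⟩
      simpa only [this] using hv)
    (by
      intro n f hprev
      have hsub : F ∪ before n f ⊆ Y := by
        rintro x (hx | ⟨j, hj, k, rfl⟩)
        · exact hFY hx
        · exact (hprev j hj).1 k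
      obtain ⟨v, hv, hv'⟩ := hY.exists_tuple_mem hE hχ hsub (hF.union (hbefore n f))
        (fun _ : Fin 1 => c)
      obtain ⟨w, hw, hw'⟩ := hY.exists_tuple_mem hE hχ (B := F ∪ before n f ∪ Set.range v)
        (Set.union_subset hsub (Set.range_subset_iff.2 hv))
        ((hF.union (hbefore n f)).union (Set.finite_range v)) b
      refine ⟨Sum.elim v w, ?_, hv', ?_⟩
      · rintro (k | k)
        · exact hv k
        · exact hw k
      · exact hw')
  -- A map between earlier entries extends to the next copies of `c` because `tp(c, X)` does not
  -- split over `F`, and then to the copies of `b` because `tp(b, Y)` does not.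
  have hind : OrderIndiscernible L F u := by
    intro S
    induction S using Finset.induction_on_max with
    | empty =>
      intro h h' _ _
      refine (isElem_diag F).mono (Set.union_subset subset_rfl ?_)
      rintro _ ⟨s, hs, -⟩
      simp at hs
    | insert a S haS ih =>
      intro h h' hh hh'
      have hsub : (S : Set ℚ) ⊆ (↑(insert a S) : Set ℚ) := by simp
      have ham : a ∈ (↑(insert a S) : Set ℚ) := by simp
      let Γ : Set (C × C) := diag F ∪ pairsOn S (fun s => u (h s)) fun s => u (h' s)
      have hΓ : IsFiniteElemOn L Y Γ := by
        refine ⟨ih h h' (hh.mono hsub) (hh'.mono hsub),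
          (hF.image _).union (pairsOn_finite S.finite_toSet _ _), ?_⟩
        rintro _ (⟨x, hx, rfl⟩ | ⟨s, hs, k, rfl⟩)
        · exact ⟨hFY hx, hFY hx⟩
        · exact ⟨(hu _).1 k, (hu _).1 k⟩
      have hfst : Prod.fst '' Γ ⊆ F ∪ before (h a) u := by
        rintro _ ⟨_, ⟨x, hx, rfl⟩ | ⟨s, hs, k, rfl⟩, rfl⟩
        · exact Or.inl hx
        · exact Or.inr ⟨h s, hh (hsub hs) ham (haS s hs), k, rfl⟩
      have hsnd : Prod.snd '' Γ ⊆ F ∪ before (h' a) u := by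
        rintro _ ⟨_, ⟨x, hx, rfl⟩ | ⟨s, hs, k, rfl⟩, rfl⟩
        · exact Or.inl hx
        · exact Or.inr ⟨h' s, hh' (hsub hs) ham (haS s hs), k, rfl⟩
      have hΓX : IsFiniteElemOn L X Γ :=
        ⟨hΓ.isElem, hΓ.finite, hΓ.subset.trans (Set.prod_mono hYX hYX)⟩
      have h1 := hc.isElem hΓX Set.subset_union_left ((hu (h a)).2.1.mono hfst)
        ((hu (h' a)).2.1.mono hsnd).symm
      let Δ : Set (C × C) := Γ ∪ pairs (u (h a) ∘ Sum.inl) (u (h' a) ∘ Sum.inl)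
      have hΔ : IsFiniteElemOn L Y Δ := by
        refine ⟨h1, hΓ.finite.union (Set.finite_range _), Set.union_subset hΓ.subset ?_⟩
        rintro _ ⟨k, rfl⟩
        exact ⟨(hu _).1 _, (hu _).1 _⟩
      have hfst' : Prod.fst '' Δ ⊆ F ∪ before (h a) u ∪ Set.range (u (h a) ∘ Sum.inl) := by
        rintro _ ⟨z, hz | ⟨k, rfl⟩, rfl⟩
        · exact Or.inl (hfst ⟨z, hz, rfl⟩)
        · exact Or.inr ⟨k, rfl⟩
      have hsnd' : Prod.snd '' Δ ⊆ F ∪ before (h' a) u ∪ Set.range (u (h' a) ∘ Sum.inl) := by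
        rintro _ ⟨z, hz | ⟨k, rfl⟩, rfl⟩
        · exact Or.inl (hsnd ⟨z, hz, rfl⟩)
        · exact Or.inr ⟨k, rfl⟩
      have h2 := hbY.isElem hΔ (fun z hz => Or.inl (Or.inl hz)) ((hu (h a)).2.2.mono hfst')
        ((hu (h' a)).2.2.mono hsnd').symm
      refine h2.mono ?_
      rintro z (hz | ⟨s, hs, k, rfl⟩)
      · exact Or.inl (Or.inl (Or.inl hz))
      · rcases Finset.mem_insert.1 hs with rfl | hs
        · rcases k with k | k
          · exact Or.inl (Or.inr ⟨k, rfl⟩)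
          · exact Or.inr ⟨k, rfl⟩
        · exact Or.inl (Or.inl (Or.inr ⟨s, hs, k, rfl⟩))
  -- The order of two entries may be exchanged. By nonsplitting, `(c', b)` looks like an earlier
  -- copy of `c` with a later copy of `b`, and `(c, b)` like a later copy of `c` with an earlier
  -- copy of `b`.
  have key := hind.eqTp hb hE hχ hF (ι := Fin 1) (κ := κ) Sum.inl Sum.inr
  have huY : ∀ n k, u n k ∈ Y := fun n => (hu n).1
  have hc0 : ∀ n, EqTp L F (u n ∘ Sum.inl) (fun _ => c) := fun n =>
    (hu n).2.1.mono Set.subset_union_left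
  have hb0 : ∀ n, EqTp L F (u n ∘ Sum.inr) b := fun n =>
    (hu n).2.2.mono fun x hx => Or.inl (Or.inl hx)
  have e1 : EqTp L F (Sum.elim (fun _ : Fin 1 => c') b) (Sum.elim (u 0 ∘ Sum.inl) b) :=
    (hbY.sumElim_left hF hFY (fun _ => hc') (fun _ => huY _ _) (hcc'.trans (hc0 0).symm)).sum_swap
  have e2 : EqTp L F (Sum.elim (u 0 ∘ Sum.inl) b) (Sum.elim (u 0 ∘ Sum.inl) (u 1 ∘ Sum.inr)) := by
    refine EqTp.sumElim_left ((hu 1).2.2.mono ?_).symm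
    rintro x (hx | ⟨k, rfl⟩)
    · exact Or.inl (Or.inl hx)
    · exact Or.inl (Or.inr ⟨0, one_pos, _, rfl⟩)
  have e3 : EqTp L F (Sum.elim (u 1 ∘ Sum.inl) (u 0 ∘ Sum.inr))
      (Sum.elim (fun _ => c) (u 0 ∘ Sum.inr)) := by
    refine EqTp.sumElim_right ((hu 1).2.1.mono ?_)
    rintro x (hx | ⟨k, rfl⟩)
    · exact Or.inl hx
    · exact Or.inr ⟨0, one_pos, _, rfl⟩
  have e4 : EqTp L F (Sum.elim (fun _ : Fin 1 => c) (u 0 ∘ Sum.inr)) (Sum.elim (fun _ => c) b) :=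
    hc.sumElim_left hF (hFY.trans hYX) (fun _ => hYX (huY _ _)) hbX (hb0 0)
  exact (((e1.trans e2).trans key).trans e3).trans e4

end Commuting

/-! ### Stages of a construction -/

section Stages

variable {C : Type u}

/-- The set `A ∪ {aⱼ : j < i}`. -/
def stage (A : Set C) (a : Ordinal.{u} → C) (i : Ordinal.{u}) : Set C := A ∪ a '' Set.Iio i

theorem stage_mono (A : Set C) (a : Ordinal.{u} → C) : Monotone (stage A a) := fun _ _ h =>
  Set.union_subset_union_right _ (Set.image_mono (Set.Iio_subset_Iio h))

theorem mem_stage {A : Set C} {a : Ordinal.{u} → C} {i j : Ordinal.{u}} (h : j < i) :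
    a j ∈ stage A a i := Or.inr ⟨j, h, rfl⟩

theorem stage_congr {A : Set C} {a a' : Ordinal.{u} → C} {i : Ordinal.{u}}
    (h : ∀ j < i, a j = a' j) : stage A a i = stage A a' i := by
  have : a '' Set.Iio i = a' '' Set.Iio i := Set.image_congr h
  rw [stage, stage, this]

theorem mk_stage_le (A : Set C) (a : Ordinal.{u} → C) (i : Ordinal.{u}) :
    #(stage A a i) ≤ #A + i.card := by
  refine (mk_union_le _ _).trans (add_le_add le_rfl ?_)
  refine Cardinal.lift_le.{u + 1}.1 (mk_image_le_lift.trans ?_)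
  rw [Cardinal.mk_Iio_ordinal, Cardinal.lift_lift]

theorem aleph0_le_cof_of_isSuccLimit {δ : Ordinal.{u}} (hδ : Order.IsSuccLimit δ) : ℵ₀ ≤ δ.cof :=
  Ordinal.aleph0_le_cof_iff.2 (Ordinal.one_lt_cof_iff.2 hδ)

end Stages

/-! ### The block construction and its homogeneity -/

section Construction

variable {L : FirstOrder.Language.{u, u}} {C : Type u} [L.Structure C] {χ : Cardinal.{u}}

theorem Determines.congr {B X : Set C} {c d : C} (h : Determines L B X c) (hBX : B ⊆ X)
    (hcd : EqTp L X (fun _ : Fin 1 => c) fun _ => d) : Determines L B X d :=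
  fun c' hc' => (h c' (hc'.trans (hcd.mono hBX).symm)).trans hcd

theorem mk_union_lt_of_finite {μ : Cardinal.{u}} (hμ : ℵ₀ ≤ μ) {B F : Set C} (hB : #B < μ)
    (hF : F.Finite) : #↥(B ∪ F) < μ :=
  (mk_union_le _ _).trans_lt (add_lt_of_lt hμ hB ((lt_aleph0_iff_set_finite.2 hF).trans_le hμ))

variable (L) in
/-- The elements of `X` represent all types over `Y`, enumerated in order type `o`. -/
def Enumerates (o : Ordinal.{u}) (Y : Set C) (e : Ordinal.{u} → C) : Prop :=
  ∀ c, ∃ k < o, EqTp L Y (fun _ : Fin 1 => e k) fun _ => c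

theorem BoundedTupleRank.exists_enumerates {T : L.Theory} {D : Diagram T} [Nonempty C]
    [C ⊨ T] (hC : IsDModel D C) (hb : BoundedTupleRank L C) {κ : Cardinal.{u}} {X : Set C}
    (hX : #X + #D + ℵ₀ ≤ κ) : ∃ e, Enumerates L κ.ord X e := by
  classical
  obtain ⟨R, hR, hrep⟩ := hb.exists_representatives hC X
  have hle : #R ≤ #κ.ord.ToType := by
    rw [mk_toType, card_ord]
    exact hR.trans hX
  obtain ⟨g⟩ := hle
  let e : Ordinal.{u} → C := fun k =>
    if h : ∃ r : R, ((g r).toOrd : Ordinal) = k then h.choose else Classical.arbitrary C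
  refine ⟨e, fun c => ?_⟩
  obtain ⟨r, hr, hcr⟩ := hrep c
  refine ⟨(g ⟨r, hr⟩).toOrd, (g ⟨r, hr⟩).toOrd.2, ?_⟩
  have hex : ∃ r' : R, ((g r').toOrd : Ordinal) = (g ⟨r, hr⟩).toOrd := ⟨_, rfl⟩
  have : e (g ⟨r, hr⟩).toOrd = r := by
    have h1 : e (g ⟨r, hr⟩).toOrd = hex.choose := dif_pos hex
    have h2 := g.injective (Ordinal.ToType.mk.symm.injective (Subtype.ext hex.choose_spec))
    rw [h1, h2]
  rw [this]
  exact hcr.symm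

variable (L) in
/-- A sequence `a` constructing a model over `A` in blocks of length `κ`: the type of each `aᵢ`
over its predecessors is determined by a set of size less than `μ`, and each block realizes every
such type over the union of `A` with the preceding blocks. -/
structure IsBlockConstruction (A : Set C) (κ μ : Cardinal.{u}) (a : Ordinal.{u} → C) : Prop where
  determines : ∀ i, ∃ B ⊆ stage A a i, #B < μ ∧ Determines L B (stage A a i) (a i)
  -- The size bound ensures that one block of length `κ` can list all types over the stage.
  realizes : ∀ j, #(stage A a (κ.ord * j)) ≤ κ → ∀ (B : Set C) (c : C),
    B ⊆ stage A a (κ.ord * j) → #B < μ → Determines L B (stage A a (κ.ord * j)) c →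
      ∃ d ∈ stage A a (κ.ord * (j + 1)),
        EqTp L (stage A a (κ.ord * j)) (fun _ : Fin 1 => d) fun _ => c

/-- Step `κ.ord * j + k` treats the `k`-th type over stage `κ.ord * j`. If it is determined by a
small set, it is extended to a type over the current stage determined by finitely many more
parameters; otherwise any element with a determined type is added. -/
theorem BoundedTupleRank.exists_isBlockConstruction {T : L.Theory} {D : Diagram T} [Nonempty C]
    [C ⊨ T] (hC : IsDModel D C) (hb : BoundedTupleRank L C) (A : Set C) {κ μ : Cardinal.{u}}
    (hμ : ℵ₀ ≤ μ) (hμκ : μ ≤ κ) (hD : #D ≤ κ) : ∃ a, IsBlockConstruction L A κ μ a := by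
  have hκ : ℵ₀ ≤ κ := hμ.trans hμκ
  have hκ0 : κ.ord ≠ 0 := by
    rw [Ne, Cardinal.ord_eq_zero]
    exact (aleph0_pos.trans_le hκ).ne'
  have henum : ∀ X : Set C, ∃ e, #X ≤ κ → Enumerates L κ.ord X e := by
    intro X
    by_cases hX : #X ≤ κ
    · obtain ⟨e, he⟩ := hb.exists_enumerates hC (X := X) (κ := κ)
        (add_le_of_le hκ (add_le_of_le hκ hX hD) hκ)
      exact ⟨e, fun _ => he⟩
    · exact ⟨fun _ => Classical.arbitrary C, fun h => absurd h hX⟩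
  choose e he using henum
  obtain ⟨a, ha⟩ := exists_forall_of_wellFoundedLT (ι := Ordinal.{u}) (β := C)
    (fun i f v => (∃ B ⊆ stage A f i, #B < μ ∧ Determines L B (stage A f i) v) ∧
      ∀ B ⊆ stage A f (κ.ord * (i / κ.ord)), #B < μ →
        Determines L B (stage A f (κ.ord * (i / κ.ord)))
          (e (stage A f (κ.ord * (i / κ.ord))) (i % κ.ord)) →
        EqTp L (stage A f (κ.ord * (i / κ.ord))) (fun _ : Fin 1 => v) fun _ =>
          e (stage A f (κ.ord * (i / κ.ord))) (i % κ.ord))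
    (by
      intro i f g hfg v hv
      rw [← stage_congr hfg, ← stage_congr (i := κ.ord * (i / κ.ord)) fun j hj =>
        hfg j (hj.trans_le (Ordinal.mul_div_le _ _))]
      exact hv)
    (by
      intro i f _
      have hZY : stage A f (κ.ord * (i / κ.ord)) ⊆ stage A f i :=
        stage_mono A f (Ordinal.mul_div_le _ _)
      generalize stage A f (κ.ord * (i / κ.ord)) = Z at hZY ⊢
      generalize stage A f i = Y at hZY ⊢
      by_cases h : ∃ B ⊆ Z, #B < μ ∧ Determines L B Z (e Z (i % κ.ord))
      · obtain ⟨B, hBZ, hB, hdet⟩ := h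
        obtain ⟨c', F, hFY, hF, hc', hdet'⟩ :=
          hb.exists_determines (B := B) (X := Y) (e Z (i % κ.ord))
        exact ⟨c', ⟨B ∪ F, Set.union_subset (hBZ.trans hZY) hFY, mk_union_lt_of_finite hμ hB hF,
          hdet'⟩, fun _ _ _ _ => hdet c' hc'.symm⟩
      · obtain ⟨c', F, hFY, hF, -, hdet'⟩ :=
          hb.exists_determines (B := ∅) (X := Y) (Classical.arbitrary C)
        refine ⟨c', ⟨∅ ∪ F, Set.union_subset (Set.empty_subset _) hFY,
          mk_union_lt_of_finite hμ ?_ hF, hdet'⟩, fun B h1 h2 h3 => absurd ⟨B, h1, h2, h3⟩ h⟩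
        rw [mk_eq_zero]
        exact aleph0_pos.trans_le hμ)
  refine ⟨a, fun i => (ha i).1, fun j hj B c hBZ hB hdet => ?_⟩
  obtain ⟨k, hk, hkc⟩ := he _ hj c
  have hdiv : (κ.ord * j + k) / κ.ord = j := by
    rw [Ordinal.mul_add_div _ hκ0, Ordinal.div_eq_zero_of_lt hk, add_zero]
  have hmod : (κ.ord * j + k) % κ.ord = k := by
    rw [Ordinal.mul_add_mod_self, Ordinal.mod_eq_of_lt hk]
  have := (ha (κ.ord * j + k)).2
  rw [hdiv, hmod] at this
  refine ⟨a (κ.ord * j + k), mem_stage ?_, (this B hBZ hB (hdet.congr hBZ hkc.symm)).trans hkc⟩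
  rw [mul_add, mul_one]
  exact (add_lt_add_iff_left _).2 hk

/-- An element `a i` appears in block `i / κ.ord`, and fewer than `δ.cof` block numbers are bounded
below `δ`. -/
theorem exists_subset_stage_of_lt_cof {A : Set C} {a : Ordinal.{u} → C} {κ : Cardinal.{u}}
    (hκ : κ ≠ 0) {δ : Ordinal.{u}} (hδ : Order.IsSuccLimit δ) {B : Set C}
    (hB : B ⊆ stage A a (κ.ord * δ)) (hBc : #B < δ.cof) :
    ∃ j < δ, B ⊆ stage A a (κ.ord * j) := by
  have hκ0 : κ.ord ≠ 0 := by rwa [Ne, Cardinal.ord_eq_zero]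
  have hex : ∀ b : B, ∃ j < δ, b.1 ∈ stage A a (κ.ord * j) := by
    intro b
    rcases hB b.2 with h | ⟨i, hi, h⟩
    · exact ⟨0, hδ.bot_lt, Or.inl h⟩
    · refine ⟨i / κ.ord + 1, hδ.add_one_lt ((Ordinal.lt_mul_iff_div_lt hκ0).1 hi), ?_⟩
      rw [← h]
      refine mem_stage ?_
      rw [mul_add, mul_one]
      exact Ordinal.lt_mul_div_add i hκ0
  choose j hj hmem using hex
  refine ⟨⨆ b, j b, Ordinal.iSup_lt_of_lt_cof hBc hj, fun b hb => ?_⟩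
  refine stage_mono A a ?_ (hmem ⟨b, hb⟩)
  gcongr
  exact Ordinal.le_iSup j ⟨b, hb⟩

theorem mk_stage_mul_le {A : Set C} {a : Ordinal.{u} → C} {κ μ : Cardinal.{u}} (hκ : ℵ₀ ≤ κ)
    (hA : #A ≤ κ) (hμκ : μ ≤ κ) {j : Ordinal.{u}} (hj : j ≤ μ.ord) :
    #(stage A a (κ.ord * j)) ≤ κ := by
  refine (mk_stage_le A a _).trans (add_le_of_le hκ hA ?_)
  rw [Ordinal.card_mul, card_ord]
  refine (mul_le_mul_right (Ordinal.card_le_card hj) κ).trans ?_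
  rw [card_ord]
  exact mul_le_of_le hκ le_rfl hμκ

/-- A limit stage of the construction realizes the types over its subsets which are smaller than
its cofinality and than `μ`. -/
theorem IsBlockConstruction.realizesSmall_of_le_cof (hb : BoundedTupleRank L C) {A : Set C}
    {κ μ lam : Cardinal.{u}} {a : Ordinal.{u} → C} (ha : IsBlockConstruction L A κ μ a)
    (hμ : ℵ₀ ≤ μ) (hμκ : μ ≤ κ) (hA : #A ≤ κ) {δ : Ordinal.{u}} (hδ : Order.IsSuccLimit δ)
    (hδμ : δ ≤ μ.ord) (hcof : lam ≤ δ.cof) (hlam : lam ≤ μ) :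
    RealizesSmall L lam (stage A a (κ.ord * δ)) := by
  intro B hB hBl c
  have hκ : ℵ₀ ≤ κ := hμ.trans hμκ
  obtain ⟨j, hj, hBj⟩ := exists_subset_stage_of_lt_cof (aleph0_pos.trans_le hκ).ne' hδ hB
    (hBl.trans_le hcof)
  -- The type over `B` need not be determined over the stage; an extension of it is, and block `j`
  -- realizes that extension.
  obtain ⟨c', F, hF, hFf, hc', hdet⟩ :=
    hb.exists_determines (B := B) (X := stage A a (κ.ord * j)) c
  obtain ⟨d, hd, hdc⟩ := ha.realizes j (mk_stage_mul_le hκ hA hμκ (hj.le.trans hδμ)) (B ∪ F) c'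
    (Set.union_subset hBj hF) (mk_union_lt_of_finite hμ (hBl.trans_le hlam) hFf) hdet
  refine ⟨d, stage_mono A a ?_ hd, hc'.trans (hdc.mono hBj).symm⟩
  gcongr
  exact Order.add_one_le_of_lt hj

theorem NonSplitting.comp {F X : Set C} {ι κ : Type*} {e : ι → C} (h : NonSplitting L F X e)
    (f : κ → ι) : NonSplitting L F X (e ∘ f) := by
  intro Γ hΓ hF
  refine (h Γ hΓ hF).mono (Set.union_subset_union_right _ ?_)
  rintro _ ⟨i, rfl⟩
  exact ⟨f i, rfl⟩

theorem IsBlockConstruction.realizesSmall (hb : BoundedTupleRank L C) (hE : ExtendsElem L C χ)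
    (hχ : ℵ₀ ≤ χ) {A : Set C} {κ μ : Cardinal.{u}} {a : Ordinal.{u} → C}
    (ha : IsBlockConstruction L A κ μ a) (hμ : ℵ₀ ≤ μ) (hμκ : μ ≤ κ) (hA : #A ≤ κ) :
    RealizesSmall L μ (stage A a (κ.ord * μ.ord)) := by
  intro B hB hBμ c
  have hκ : ℵ₀ ≤ κ := hμ.trans hμκ
  have hlim : Order.IsSuccLimit μ.ord := isSuccLimit_ord hμ
  have hstep : ∀ {δ : Ordinal.{u}} {lam : Cardinal.{u}}, Order.IsSuccLimit δ → δ ≤ μ.ord →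
      lam ≤ δ.cof → lam ≤ μ → RealizesSmall L lam (stage A a (κ.ord * δ)) :=
    fun h1 h2 h3 h4 => ha.realizesSmall_of_le_cof hb hμ hμκ hA h1 h2 h3 h4
  -- Below the cofinality `B` lies in a proper stage. The remaining case occurs only for singular
  -- `μ`.
  by_cases hcof : #B < μ.ord.cof
  · exact hstep hlim le_rfl (min_le_left _ _) (min_le_right _ _) B hB (lt_min hcof hBμ) c
  have hBinf : ℵ₀ ≤ #B := (aleph0_le_cof_of_isSuccLimit hlim).trans (not_lt.1 hcof)
  have hreg := isRegular_succ hBinf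
  have hsucc : Order.succ #B < μ := by
    -- If `μ` were the successor of `#B`, it would be regular and `B` would be below its cofinality.
    refine lt_of_le_of_ne (Order.succ_le_of_lt hBμ) fun h => hcof ?_
    rw [← h, hreg.cof_ord]
    exact Order.lt_succ _
  have hX : RealizesSmall L ℵ₀ (stage A a (κ.ord * μ.ord)) :=
    hstep hlim le_rfl (aleph0_le_cof_of_isSuccLimit hlim) hμ
  obtain ⟨E, hEX, hEf, hEc⟩ := hb.exists_nonSplitting hE hχ hX fun _ : Fin 1 => c
  obtain ⟨j, hj, hEj⟩ := exists_subset_stage_of_lt_cof (aleph0_pos.trans_le hκ).ne' hlim hEX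
    ((lt_aleph0_iff_set_finite.2 hEf).trans_le (aleph0_le_cof_of_isSuccLimit hlim))
  -- Starting at `j` keeps `E` in the stage; the second summand gives cofinality `|B|⁺`, so that
  -- stage realizes types over sets of size `|B|`.
  let δ : Ordinal.{u} := j + (Order.succ #B).ord
  have hslim : Order.IsSuccLimit (Order.succ #B).ord := isSuccLimit_ord hreg.aleph0_le
  have hδcof : δ.cof = Order.succ #B := by
    rw [Ordinal.cof_map_of_isNormal (Ordinal.isNormal_add_right j) hslim, hreg.cof_ord]
  have hδlim : Order.IsSuccLimit δ := by
    rw [← Ordinal.one_lt_cof_iff, hδcof]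
    exact one_lt_aleph0.trans_le hreg.aleph0_le
  have hδμ : δ < μ.ord := Ordinal.isPrincipal_add_ord hμ hj (ord_lt_ord.2 hsucc)
  have hEY : E ⊆ stage A a (κ.ord * δ) := hEj.trans (stage_mono A a (by gcongr; simp [δ]))
  have hYX : stage A a (κ.ord * δ) ⊆ stage A a (κ.ord * μ.ord) :=
    stage_mono A a (by gcongr)
  have hY : RealizesSmall L ℵ₀ (stage A a (κ.ord * δ)) :=
    hstep hδlim hδμ.le (aleph0_le_cof_of_isSuccLimit hδlim) hμ
  have hex : ∀ S : Finset B, ∃ F ⊆ stage A a (κ.ord * δ), F.Finite ∧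
      NonSplitting L F (stage A a (κ.ord * δ)) fun b : S => (b.1 : C) := by
    intro S
    obtain ⟨F, h1, h2, h3⟩ :=
      hb.exists_nonSplitting hE hχ hY fun i : Fin S.card => ((S.equivFin.symm i).1 : C)
    refine ⟨F, h1, h2, ?_⟩
    have := h3.comp S.equivFin
    convert this using 1
    funext b
    simp
  choose F hFY hFf hFS using hex
  have hN : #↥(⋃ S, F S) < Order.succ #B := by
    refine Order.lt_succ_iff.2 ((mk_iUnion_le _).trans (mul_le_of_le hBinf ?_ ?_))
    · exact (mk_finset_le _).trans (max_le hBinf le_rfl)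
    · exact ciSup_le' fun S => ((lt_aleph0_iff_set_finite.2 (hFf S)).le).trans hBinf
  -- Agreement with `c` over all the finite supports suffices: symmetry, applied to each finite
  -- tuple of `B`, gives agreement over `B`.
  obtain ⟨c', hc'Y, hcc'⟩ := hstep hδlim hδμ.le hδcof.ge hsucc.le ((⋃ S, F S) ∪ E)
    (Set.union_subset (Set.iUnion_subset hFY) hEY)
    (mk_union_lt_of_finite hreg.aleph0_le hN hEf) c
  refine ⟨c', hYX hc'Y, eqTp_of_forall_finite fun G hG hGf => ?_⟩
  have hfin : (Subtype.val ⁻¹' G : Set B).Finite := hGf.preimage Subtype.val_injective.injOn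
  have hsub : F hfin.toFinset ∪ E ⊆ (⋃ S, F S) ∪ E :=
    Set.union_subset_union_left _ (Set.subset_iUnion F _)
  have key := NonSplitting.eqTp_of_eqTp hb hE hχ hYX hY ((hFf hfin.toFinset).union hEf)
    (Set.union_subset (hFY _) hEY) (b := fun b : hfin.toFinset => (b.1 : C))
    (fun b => hB b.1.2) (hEc.mono Set.subset_union_right)
    ((hFS hfin.toFinset).mono Set.subset_union_left) hc'Y (hcc'.mono hsub).symm
  refine EqTp.symm (IsElem.mono key ?_)
  rintro z (hz | ⟨i, rfl⟩)
  · obtain ⟨h1, h2⟩ := mem_diag.1 hz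
    exact Or.inr ⟨Sum.inr ⟨⟨z.1, hG h1⟩, by simpa using h1⟩, Prod.ext rfl h2⟩
  · exact Or.inr ⟨Sum.inl i, rfl⟩

end Construction

/-! ### Elementary substructures from realized types -/

section ElementarySubstructure

variable {L : FirstOrder.Language.{u, u}} {C : Type u} [L.Structure C] {χ : Cardinal.{u}}

/-- The Tarski-Vaught test, for sets realizing the types over their finite subsets. -/
theorem RealizesSmall.exists_elementarySubstructure {X : Set C} (hX : RealizesSmall L ℵ₀ X) :
    ∃ M : L.ElementarySubstructure C, (M : Set C) = X := by
  have hfin : ∀ {n : ℕ} (x : Fin n → C), #(Set.range x) < ℵ₀ := fun x =>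
    lt_aleph0_iff_set_finite.2 (Set.finite_range x)
  let S : L.Substructure C :=
    { carrier := X
      fun_mem := by
        intro n f x hx
        obtain ⟨d, hd, hcd⟩ := hX (Set.range x) (Set.range_subset_iff.2 hx) (hfin x)
          (Language.Structure.funMap f x)
        have := hcd.realize_iff (Sum.elim x fun _ : Fin 1 => Language.Structure.funMap f x)
          (Sum.elim x fun _ : Fin 1 => d) (by
            rintro (i | i)
            · exact Or.inl ⟨x i, ⟨i, rfl⟩, rfl⟩
            · exact Or.inr ⟨i, rfl⟩)
          ((Language.Term.func f fun i => Language.Term.var (Sum.inl i)).equal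
            (Language.Term.var (Sum.inr 0)))
        simp only [Language.Formula.realize_equal, Language.Term.realize_func,
          Language.Term.realize_var, Sum.elim_inl, Sum.elim_inr, true_iff] at this
        rwa [this] }
  refine ⟨S.toElementarySubstructure fun n φ x a hφ => ?_, rfl⟩
  obtain ⟨b, hb, hab⟩ := hX (Set.range fun i => (x i : C))
    (Set.range_subset_iff.2 fun i => (x i).2) (hfin _) a
  refine ⟨⟨b, hb⟩, ?_⟩
  have := hab.realize_iff (Sum.elim (default : Empty → C) (Fin.snoc (fun i => (x i : C)) a))
    (Sum.elim (default : Empty → C) (Fin.snoc (fun i => (x i : C)) b)) (by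
      rintro (i | i)
      · exact i.elim
      · refine Fin.lastCases ?_ (fun i => ?_) i
        · exact Or.inr ⟨0, by simp⟩
        · exact Or.inl ⟨x i, ⟨i, rfl⟩, by simp⟩) φ.toFormula
  rw [Language.BoundedFormula.realize_toFormula, Language.BoundedFormula.realize_toFormula] at this
  exact this.1 hφ

end ElementarySubstructure

/-! ### Embedding constructible sets -/

section Prime

variable {L : FirstOrder.Language.{u, u}} {C : Type u} [L.Structure C] {χ : Cardinal.{u}}

theorem IsElem.mk_le_fst {Γ : Set (C × C)} (h : IsElem L Γ) : #Γ ≤ #(Prod.fst '' Γ) := by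
  refine mk_le_of_injective (f := fun z : Γ => (⟨z.1.1, z, z.2, rfl⟩ : Prod.fst '' Γ)) ?_
  intro z w hzw
  have h1 : z.1.1 = w.1.1 := congrArg Subtype.val hzw
  exact Subtype.ext (Prod.ext h1 ((h.eq_iff z.2 w.2).1 h1))

/-- One step of the embedding of a constructible set. -/
theorem Determines.exists_extension (hE : ExtendsElem L C χ) {μ : Cardinal.{u}} {Γ : Set (C × C)}
    (hΓ : IsElem L Γ) (hΓχ : #Γ < χ) {N B : Set C} (hN : RealizesSmall L μ N)
    (hΓN : ∀ z ∈ Γ, z.2 ∈ N) {c : C} (hBΓ : B ⊆ Prod.fst '' Γ) (hB : #B < μ)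
    (hc : Determines L B (Prod.fst '' Γ) c) : ∃ d ∈ N, IsElem L (insert (c, d) Γ) := by
  let Γ₀ : Set (C × C) := {z ∈ Γ | z.1 ∈ B}
  have hΓ₀ : Γ₀ ⊆ Γ := fun z hz => hz.1
  have hfst : Prod.fst '' Γ₀ = B := by
    ext x
    constructor
    · rintro ⟨z, hz, rfl⟩
      exact hz.2
    · intro hx
      obtain ⟨z, hz, rfl⟩ := hBΓ hx
      exact ⟨z, ⟨hz, hx⟩, rfl⟩
  have hΓ₀c : #Γ₀ ≤ #B := hfst ▸ (hΓ.mono hΓ₀).mk_le_fst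
  -- The image `d₀` in `C` may lie outside `N`; only its type over the image of `B`, a set of size
  -- less than `μ`, is kept when passing to `d ∈ N`.
  obtain ⟨d₀, hd₀⟩ := hE Γ hΓ hΓχ c
  obtain ⟨d, hd, hdd⟩ := hN (Prod.snd '' Γ₀) (by rintro _ ⟨z, hz, rfl⟩; exact hΓN z hz.1)
    (mk_image_le.trans_lt (hΓ₀c.trans_lt hB)) d₀
  have h0 : IsElem L (Γ₀ ∪ pairs (fun _ : Fin 1 => c) fun _ => d₀) := by
    rw [pairs_const, Set.union_comm, ← Set.insert_eq]
    exact hd₀.mono (Set.insert_subset_insert hΓ₀)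
  have h1 := h0.trans_eqTp hdd
  -- Pulling `d` back along all of `Γ` gives `c'` with the type of `c` over `B`, hence over the
  -- whole domain, so `c` may be sent to `d`.
  obtain ⟨c', hc'⟩ := hE (Prod.swap '' Γ) (hΓ.inv (by rintro _ ⟨z, hz, rfl⟩; exact hz))
    (mk_image_le.trans_lt hΓχ) d
  have h2 : IsElem L (Γ ∪ pairs (fun _ : Fin 1 => c') fun _ => d) := by
    refine hc'.inv ?_
    rintro z (hz | ⟨-, rfl⟩)
    · exact Or.inr ⟨z, hz, rfl⟩
    · exact Or.inl rfl
  have h3 : EqTp L B (fun _ : Fin 1 => c') fun _ => c := by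
    rw [← hfst]
    exact (h2.mono_left hΓ₀).eqTp_fst h1 (EqTp.refl _ _)
  have h4 := (hc c' h3).symm.trans_isElem h2
  rw [pairs_const, Set.union_comm, ← Set.insert_eq] at h4
  exact ⟨d, hd, h4⟩

/-- Zorn's lemma for elementary maps into `N` that fix `A` and are defined on a stage;
`Determines.exists_extension` forces a maximal one to be defined everywhere. -/
theorem exists_isElem_stage (hE : ExtendsElem L C χ) {μ : Cardinal.{u}} {A N : Set C}
    (hN : RealizesSmall L μ N) (hAN : A ⊆ N) {a : Ordinal.{u} → C} {α : Ordinal.{u}}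
    (hχ : #(stage A a α) < χ)
    (ha : ∀ i < α, ∃ B ⊆ stage A a i, #B < μ ∧ Determines L B (stage A a i) (a i)) :
    ∃ Γ : Set (C × C), IsElem L Γ ∧ diag A ⊆ Γ ∧ (∀ z ∈ Γ, z.2 ∈ N) ∧
      Prod.fst '' Γ = stage A a α := by
  let 𝒮 : Set (Set (C × C)) := {Γ | IsElem L Γ ∧ diag A ⊆ Γ ∧ (∀ z ∈ Γ, z.2 ∈ N) ∧
    ∃ i ≤ α, Prod.fst '' Γ = stage A a i}
  have hbase : diag A ∈ 𝒮 := by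
    refine ⟨isElem_diag A, subset_rfl, ?_, 0, zero_le, ?_⟩
    · rintro _ ⟨x, hx, rfl⟩
      exact hAN hx
    · rw [diag, Set.image_image]
      simp [stage]
  obtain ⟨Γ, -, hmax⟩ := zorn_subset_nonempty 𝒮 (by
    intro c hc hchain hne
    refine ⟨⋃₀ c, ⟨?_, ?_, ?_, ?_⟩, fun s hs => Set.subset_sUnion_of_mem hs⟩
    · refine isElem_of_finite fun Δ hΔ hfin => ?_
      obtain ⟨Γ, hΓ, hΔΓ⟩ := DirectedOn.exists_mem_subset_of_finite_of_subset_sUnion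
        hne hchain.directedOn hfin hΔ
      exact (hc hΓ).1.mono hΔΓ
    · obtain ⟨Γ, hΓ⟩ := hne
      exact (hc hΓ).2.1.trans (Set.subset_sUnion_of_mem hΓ)
    · rintro z ⟨Γ, hΓ, hz⟩
      exact (hc hΓ).2.2.1 z hz
    · have hex : ∀ Γ : c, ∃ i ≤ α, Prod.fst '' Γ.1 = stage A a i := fun Γ => (hc Γ.2).2.2.2
      choose i hi himg using hex
      refine ⟨⨆ Γ, i Γ, Ordinal.iSup_le hi, ?_⟩
      ext x
      constructor
      · rintro ⟨z, ⟨Γ, hΓ, hz⟩, rfl⟩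
        refine stage_mono A a (Ordinal.le_iSup i ⟨Γ, hΓ⟩) ?_
        rw [← himg ⟨Γ, hΓ⟩]
        exact ⟨z, hz, rfl⟩
      · have hlift : ∀ Γ : c, x ∈ stage A a (i Γ) → x ∈ Prod.fst '' ⋃₀ c := by
          intro Γ hx
          rw [← himg Γ] at hx
          obtain ⟨z, hz, rfl⟩ := hx
          exact ⟨z, ⟨Γ, Γ.2, hz⟩, rfl⟩
        rintro (hx | ⟨j, hj, rfl⟩)
        · obtain ⟨Γ, hΓ⟩ := hne
          exact hlift ⟨Γ, hΓ⟩ (Or.inl hx)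
        · obtain ⟨Γ, hΓ⟩ := Ordinal.lt_iSup_iff.1 hj
          exact hlift Γ (mem_stage hΓ)) _ hbase
  obtain ⟨hΓ, hAΓ, hΓN, i, hi, himg⟩ := hmax.prop
  refine ⟨Γ, hΓ, hAΓ, hΓN, ?_⟩
  by_contra hne
  have hle : Prod.fst '' Γ ⊆ stage A a α := himg ▸ stage_mono A a hi
  have hex : ∃ j, j < α ∧ a j ∉ Prod.fst '' Γ := by
    by_contra hall
    push Not at hall
    refine hne (hle.antisymm ?_)
    rintro x (hx | ⟨j, hj, rfl⟩)
    · rw [himg]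
      exact Or.inl hx
    · exact hall j hj
  -- The sequence may repeat values, so `a i` may already be in the domain. The least missing index
  -- `j` still has the domain as its stage.
  obtain ⟨j, ⟨hjα, hj⟩, hjmin⟩ := WellFounded.has_min wellFounded_lt
    {j | j < α ∧ a j ∉ Prod.fst '' Γ} hex
  have hij : Prod.fst '' Γ = stage A a j := by
    refine Set.Subset.antisymm ?_ ?_
    · rw [himg]
      refine stage_mono A a (not_lt.1 fun hlt => hj ?_)
      rw [himg]
      exact mem_stage hlt
    · rintro x (hx | ⟨k, hk, rfl⟩)
      · rw [himg]
        exact Or.inl hx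
      · by_contra hn
        exact hjmin k ⟨lt_trans hk hjα, hn⟩ hk
  obtain ⟨B, hB, hBμ, hdet⟩ := ha j hjα
  have hΓχ : #Γ < χ := hΓ.mk_le_fst.trans_lt ((mk_le_mk_of_subset hle).trans_lt hχ)
  rw [← hij] at hB hdet
  obtain ⟨d, hd, hext⟩ := hdet.exists_extension hE hΓ hΓχ hN hΓN hB hBμ
  have hmem : insert (a j, d) Γ ∈ 𝒮 := by
    refine ⟨hext, hAΓ.trans (Set.subset_insert _ _), ?_, j + 1, Order.add_one_le_of_lt hjα, ?_⟩
    · rintro z (rfl | hz)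
      · exact hd
      · exact hΓN z hz
    · rw [Set.image_insert_eq, hij]
      ext x
      constructor
      · rintro (rfl | hx)
        · exact mem_stage (lt_add_one j)
        · exact stage_mono A a (lt_add_one j).le hx
      · rintro (hx | ⟨k, hk, rfl⟩)
        · exact Or.inr (Or.inl hx)
        · rcases (Order.lt_add_one_iff.1 (Set.mem_Iio.1 hk)).lt_or_eq with hk | rfl
          · exact Or.inr (mem_stage hk)
          · exact Or.inl rfl
  exact hj ⟨_, hmax.le_of_ge hmem (Set.subset_insert _ _) (Or.inl rfl), rfl⟩

/-- An elementary relation from an elementary substructure `M` into an elementary substructure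
`N` is an elementary embedding. -/
theorem IsElem.exists_elementaryEmbedding {Γ : Set (C × C)} (hΓ : IsElem L Γ)
    {M N : L.ElementarySubstructure C} (hM : ∀ x : M, ∃ z ∈ Γ, z.1 = (x : C))
    (hN : ∀ z ∈ Γ, z.2 ∈ N) : ∃ f : M ↪ₑ[L] N, ∀ x : M, ((x : C), (f x : C)) ∈ Γ := by
  have hex : ∀ x : M, ∃ y : N, ((x : C), (y : C)) ∈ Γ := by
    intro x
    obtain ⟨⟨x', y⟩, hz, hx⟩ := hM x
    exact ⟨⟨y, hN _ hz⟩, hx ▸ hz⟩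
  choose f hf using hex
  refine ⟨⟨f, fun n φ x => ?_⟩, hf⟩
  rw [← N.subtype.map_formula, ← M.subtype.map_formula]
  exact (hΓ.realize_iff _ _ (fun i => hf (x i)) φ).symm

end Prime

end FiniteDiagram

/-! ### The theorem -/

theorem theorem4p5 {L : FirstOrder.Language.{u, u}} (T : L.Theory)
    (D : FiniteDiagram.Diagram T)
    (C : Type u) [L.Structure C] [Nonempty C] [C ⊨ T]
    (χ : Cardinal.{u}) (hC : FiniteDiagram.IsHomogeneous D χ C)
    (htt : FiniteDiagram.IsTotallyTranscendental D C)
    (A : Set C) (μ : Cardinal.{u}) (hμ : ℵ₀ ≤ μ)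
    (hχ : #A + max L.card ℵ₀ + #D + μ < χ) :
    ∃ M : L.ElementarySubstructure C,
      FiniteDiagram.IsPrimary D μ A M ∧
      #M ≤ #A + max L.card ℵ₀ + #D + μ ∧
      (μ ≤ #C → (∀ n, ∀ q : T.CompleteType (Fin n),
          (⟨n, q⟩ : Σ n : ℕ, T.CompleteType (Fin n)) ∈ D → q ∈ T.realizedTypes C (Fin n)) →
        #A + #D + μ ≤ #M) ∧
      FiniteDiagram.IsPrimeOver D μ A M := by
  open FiniteDiagram in
  generalize hκ : #A + max L.card ℵ₀ + #D + μ = κ at hχ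
  have hA : #A ≤ κ := by
    rw [← hκ, add_assoc, add_assoc]
    exact self_le_add_right _ _
  have hD : #D ≤ κ := by
    rw [← hκ]
    exact (self_le_add_left _ _).trans (self_le_add_right _ _)
  have hμκ : μ ≤ κ := by
    rw [← hκ]
    exact self_le_add_left _ _
  have hχ0 : ℵ₀ ≤ χ := (hμ.trans hμκ).trans hχ.le
  have hb := htt.boundedTupleRank hC.1
  have hE : ExtendsElem L C χ := hC.extendsElem
  obtain ⟨a, ha⟩ := hb.exists_isBlockConstruction hC.1 A hμ hμκ hD
  have hX := ha.realizesSmall hb hE hχ0 hμ hμκ hA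
  have hXκ : #(stage A a (κ.ord * μ.ord)) ≤ κ := mk_stage_mul_le (hμ.trans hμκ) hA hμκ le_rfl
  generalize κ.ord * μ.ord = α at hX hXκ
  have hX0 : RealizesSmall L ℵ₀ (stage A a α) := fun B hB hBc => hX B hB (hBc.trans_le hμ)
  obtain ⟨M, hM⟩ := hX0.exists_elementarySubstructure
  have hmk : #M = #(stage A a α) := by
    rw [← hM]
    rfl
  have hAM : A ⊆ (M : Set C) := hM ▸ Set.subset_union_left
  have hhom : IsHomogeneous D μ M :=
    RealizesSmall.isHomogeneous hC (hμκ.trans hχ.le) (by rwa [hM])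
  refine ⟨M, ⟨?_, hhom⟩, hmk.trans_le hXκ, fun hμC hreal => ?_, hAM, hhom, fun N hN hAN => ?_⟩
  · choose B hB using ha.determines
    refine ⟨α, a, B, hM, fun i hi => ?_⟩
    exact Determines.isIsolatedOver hC
      ((mk_le_mk_of_subset (stage_mono A a hi.le)).trans_lt (hXκ.trans_lt hχ)) (hB i).1 (hB i).2.1
      (hB i).2.2
  · have hμM : μ ≤ #M := by
      -- If `#M < μ`, then `M` realizes all types over itself, and an element with the type over `M`
      -- of some `c ∉ M` would equal `c`.
      by_contra hlt
      rw [hmk, not_le] at hlt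
      have hne : ∃ c, c ∉ stage A a α := by
        by_contra hall
        push Not at hall
        rw [Set.eq_univ_of_forall hall, mk_univ] at hlt
        exact hlt.not_ge hμC
      obtain ⟨c, hc⟩ := hne
      obtain ⟨d, hd, hcd⟩ := hX _ subset_rfl hlt c
      exact hc (hcd.symm.eq_of_mem 0 hd ▸ hd)
    have hMinf : ℵ₀ ≤ #M := hμ.trans hμM
    refine add_le_of_le hMinf (add_le_of_le hMinf (mk_le_mk_of_subset hAM) ?_) hμM
    -- Each type in `D` is realized in `C`, hence by a finite tuple of `M`, so counting finite
    -- tuples bounds `D`.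
    have hle : #D ≤ #(Σ n : ℕ, Fin n → M) := by
      refine (mk_le_mk_of_subset ?_).trans (mk_range_le (f := fun s : Σ n : ℕ, Fin n → M =>
        (⟨s.1, T.typeOf fun i => (s.2 i : C)⟩ : Σ n : ℕ, T.CompleteType (Fin n))))
      rintro ⟨n, q⟩ hq
      obtain ⟨c, rfl⟩ := hreal n q hq
      obtain ⟨d, hd, hdc⟩ := hX0.exists_tuple_mem hE hχ0 (Set.empty_subset _) Set.finite_empty c
      refine ⟨⟨n, fun i => ⟨d i, ?_⟩⟩, ?_⟩
      · have := hd i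
        rwa [← hM] at this
      · exact congrArg (Sigma.mk n) (typeOf_eq_iff.2 fun φ =>
          hdc.realize_iff _ _ (fun i => Or.inr ⟨i, rfl⟩) φ)
    refine hle.trans ?_
    rw [← mk_congr List.equivSigmaTuple]
    exact (mk_list_le_max M).trans (max_le hMinf le_rfl)
  · obtain ⟨Γ, hΓ, hAΓ, hΓN, himg⟩ := exists_isElem_stage hE (hN.realizesSmall hC.1) hAN
      (hXκ.trans_lt hχ) fun i _ => ha.determines i
    obtain ⟨f, hf⟩ := hΓ.exists_elementaryEmbedding (M := M) (N := N) (fun x => by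
      have : (x : C) ∈ Prod.fst '' Γ := by
        rw [himg, ← hM]
        exact x.2
      exact this) hΓN
    exact ⟨f, fun x hx => ((hΓ.eq_iff (hf x) (hAΓ ⟨x, hx, rfl⟩)).1 rfl)⟩
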